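/- **Setting.** Let $G$ be the $(N\times N)$-oriented grid with $n=N^2$ nodes (nodes are lattice points; every node knows the cardinal directions of its edges), and let $\mathrm{dist}$ denote the graph distance. A deterministic online-LOCAL algorithm with locality $T$ receives the nodes one by one in an adversarial order. When a node is revealed, the algorithm irrevocably gives it one of the colors $1,2,3$. Its choice depends only on the sequence of nodes revealed so far, their colors, and the oriented subgraph induced by the union of the radius-$T$ balls around them, up to direction-preserving isomorphism. For a coloring $c$, the potential of an edge from $x$ to $y$ is $c(x)-c(y)$ if neither color is $3$, and $0$ otherwise. The potential $p(P)$ of a walk $P$ is the sum over its edges. A $(j,\theta)$-parallelogram is a parallelogram in the plane with two vertical sides of length $j+1$ and two sides at angle $\theta$ to the $x$-axis; its width is its horizontal extent. An L-path is a simple path consisting of a part within one row followed by a part, with at least one edge, within one column. For nodes $u=(x_0,y_0)$ and $v=(x_1,y_1)$ with $x_0<x_1$ and slope $m=(y_1-y_0)/(x_1-x_0)$, $|m|\le 1$, the diagonal path $D_{u,v}$ consists of the nodes $(x,\,y_0+\lfloor m(x-x_0)\rfloor)$, $x_0\le x\le x_1$. When $D_{u,v}$ is revealed or traversed, two consecutive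 nodes of it that are not adjacent are joined by one horizontal and then one vertical edge. For two nodes $u_1,v_1$ of $D_{u,v}$, $D_{u,v}[u_1,v_1]$ is the part between them. **Lemma.** There is an absolute constant $C$ such that the following holds for every $T=T(n)=o(\log n)$, every $\delta>0$, every sufficiently large $N$ (with $n=N^2$ and $T=T(n)$), and every deterministic online-LOCAL algorithm with locality $T$ on the $(N\times N)$-oriented grid. Suppose that the adversary has so far revealed, in some order, exactly the nodes of $W$ and $D_{u,v}$, where $W$ is an L-path from $u$ to $v$, $u$ lies west of $v$, the row part of $W$ has at least $2^{100T}$ edges and at least as many edges as the column part, and all coordinates of nodes of $W$ lie between $\delta N$ and $(1-\delta)N$. Suppose that the coloring produced so far extends to a proper $3$-coloring of $G$ and that $p(W)=0$. Let $\theta$ be the angle of the line through $u$ and $v$ with the $x$-axis. Then the adversary can continue by revealing further nodes, all contained in a single $(10T+1,\theta)$-parallelogram of width at most $2^{10T}\cdot C\,T$ and all at distance at least $2T+2$ from every previously revealed node, such that either the algorithm fails by giving two adjacent newly revealed nodes the same color, or there is a path $R$ of newly revealed nodes, from a node $v_2=(a_{v_2},b_{v_2})$ to a node $u_2=(a_{u_2},b_{u_2})$,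 with the following properties: 1. $p(R)=10T$ (and $R$, like all newly revealed nodes, lies in the $(10T+1,\theta)$-parallelogram above); 2. there is a subpath $D_{u,v}[u_1,v_1]$ of the diagonal path from $u_1=(a_{u_1},b_{u_1})$ to $v_1=(a_{v_1},b_{v_1})$ with $|a_{u_1}-a_{v_1}|=|a_{u_2}-a_{v_2}|$ and $|p(D_{u,v}[u_1,v_1])|\le 2$; 3. $2T+2\le \mathrm{dist}(D_{u,v}[u_1,v_1],R)\le 12T+7$, where the distance is the minimum of $\mathrm{dist}(x,y)$ over nodes $x$ of $R$ and $y$ of $D_{u,v}[u_1,v_1]$. -/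

import Mathlib

open Filter Asymptotics

namespace OnlineGrid

/-! ### The oriented grid -/

/-- Lattice points `(x, y)`; `x` grows to the east and `y` grows to the north. -/
abbrev Node := ℤ × ℤ

/-- The nodes of the `N × N` grid are the lattice points with both coordinates in `1, …, N`. -/
def InGrid (N : ℕ) (z : Node) : Prop :=
  1 ≤ z.1 ∧ z.1 ≤ N ∧ 1 ≤ z.2 ∧ z.2 ≤ N

/-- `East N z w`: `w` is the eastern neighbour of `z` in the `N × N` grid. -/
def East (N : ℕ) (z w : Node) : Prop :=
  InGrid N z ∧ InGrid N w ∧ w.1 = z.1 + 1 ∧ w.2 = z.2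

/-- `North N z w`: `w` is the northern neighbour of `z` in the `N × N` grid. -/
def North (N : ℕ) (z w : Node) : Prop :=
  InGrid N z ∧ InGrid N w ∧ w.1 = z.1 ∧ w.2 = z.2 + 1

/-- The underlying undirected graph of the oriented `N × N` grid. Lattice points outside of the
grid are isolated vertices (at infinite `edist` from everything else). -/
def grid (N : ℕ) : SimpleGraph Node where
  Adj z w := East N z w ∨ East N w z ∨ North N z w ∨ North N w z
  symm := ⟨fun z w h => by tauto⟩
  loopless := ⟨fun z h => by
    rcases h with h | h | h | h <;> obtain ⟨-, -, h1, h2⟩ := h <;> omega⟩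

/-! ### Deterministic online-LOCAL algorithms -/

/-- The part of the grid an algorithm of locality `T` has seen after the nodes in `l` have been
revealed: the union of the balls of radius `T` around them. -/
def view (N T : ℕ) (l : List Node) : Set Node :=
  {w | ∃ v ∈ l, (grid N).edist v w ≤ (T : ℕ∞)}

/-- Two reveal sequences look the same to an algorithm of locality `T`: there is an isomorphism
between the induced subgraphs seen so far that respects the cardinal directions of all edges and
maps the `i`-th revealed node to the `i`-th revealed node, for every `i`. -/
def SameView (N T : ℕ) (l l' : List Node) : Prop :=
  ∃ φ : Node → Node, Set.BijOn φ (view N T l) (view N T l') ∧ l.map φ = l' ∧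
    ∀ a ∈ view N T l, ∀ b ∈ view N T l,
      (East N a b ↔ East N (φ a) (φ b)) ∧ (North N a b ↔ North N (φ a) (φ b))

/-- A deterministic online-LOCAL algorithm with locality `T` and three output labels on the
oriented `N × N` grid. `label [v₁, …, vᵢ]` is the label given to `vᵢ` at the moment it is revealed,
after `v₁, …, vᵢ₋₁`. It depends only on what the algorithm sees. (The labels given
earlier are determined by the initial segments of the sequence, so they are not
a separate argument.) -/
structure OnlineLocalAlg (N T : ℕ) where
  label : List Node → Fin 3
  label_eq : ∀ l l' : List Node, (∀ z ∈ l, InGrid N z) → (∀ z ∈ l', InGrid N z) →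
    SameView N T l l' → label l = label l'

/-- The label that the node `v` of the reveal sequence `l` received when it was revealed. -/
def OnlineLocalAlg.colorAt {N T : ℕ} (A : OnlineLocalAlg N T) (l : List Node) (v : Node) : Fin 3 :=
  A.label (l.take (l.idxOf v + 1))

/-! ### The potential -/

/-- Potential of an edge. The colors `1, 2, 3` are written `0, 1, 2 : Fin 3`, so that the special
color `3` is `2`. -/
def edgePotential (c : Node → Fin 3) (z w : Node) : ℤ :=
  if c z ≠ 2 ∧ c w ≠ 2 then ((c z : ℕ) : ℤ) - ((c w : ℕ) : ℤ) else 0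

/-- Potential of a walk, given as the list of its nodes. -/
def potential (c : Node → Fin 3) : List Node → ℤ
  | [] => 0
  | [_] => 0
  | z :: w :: l => edgePotential c z w + potential c (w :: l)

/-! ### L-paths, diagonal paths, parallelograms -/

/-- `P` is the list of nodes of a (simple) path of the `N × N` grid. -/
def IsGridPath (N : ℕ) (P : List Node) : Prop :=
  P.IsChain (grid N).Adj ∧ P.Nodup

/-- `W` is an L-path of the grid: the initial part consisting of its first `r` edges stays in one
row, and the remaining part, which has at least one edge, stays in one column. -/
def IsLPath (N : ℕ) (W : List Node) (r : ℕ) : Prop :=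
  IsGridPath N W ∧ r + 1 < W.length ∧
    (∃ y : ℤ, ∀ z ∈ W.take (r + 1), z.2 = y) ∧ (∃ x : ℤ, ∀ z ∈ W.drop r, z.1 = x)

/-- Slope of the line through `u` and `v`. -/
noncomputable def lineSlope (u v : Node) : ℝ :=
  ((v.2 : ℝ) - (u.2 : ℝ)) / ((v.1 : ℝ) - (u.1 : ℝ))

/-- The node of the diagonal path `D_{u,v}` at horizontal distance `i` from `u`. -/
noncomputable def diagNode (u v : Node) (i : ℕ) : Node :=
  (u.1 + i, u.2 + ⌊lineSlope u v * (i : ℝ)⌋)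

/-- The nodes of the part of `D_{u,v}` that starts at horizontal distance `s` from `u` and has
horizontal span `k`. -/
noncomputable def diagNodes (u v : Node) (s k : ℕ) : List Node :=
  (List.range (k + 1)).map fun i => diagNode u v (s + i)

/-- The same part of `D_{u,v}` as a walk of the grid. Consecutive nodes of `D_{u,v}` are adjacent
or lie diagonally across a unit square; in the second case the walk takes the horizontal
step first and then the vertical one. -/
noncomputable def diagWalk (u v : Node) (s : ℕ) : ℕ → List Node
  | 0 => [diagNode u v s]
  | k + 1 => diagWalk u v s k ++
      (if (diagNode u v (s + k)).2 = (diagNode u v (s + k + 1)).2 then []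
        else [((diagNode u v (s + k + 1)).1, (diagNode u v (s + k)).2)]) ++
      [diagNode u v (s + k + 1)]

/-- Horizontal span of `D_{u,v}`, for `u` west of `v`. -/
def hSpan (u v : Node) : ℕ := (v.1 - u.1).toNat

/-- The lattice points in the `(j, θ)`-parallelogram of width `w` with lower left corner `(a, b)`,
where `m = tan θ`: two sides are vertical and have length `j + 1`, the others have slope `m`. -/
def parallelogram (j : ℕ) (m a b w : ℝ) : Set Node :=
  {z | a ≤ (z.1 : ℝ) ∧ (z.1 : ℝ) ≤ a + w ∧
    b + m * ((z.1 : ℝ) - a) ≤ (z.2 : ℝ) ∧ (z.2 : ℝ) ≤ b + m * ((z.1 : ℝ) - a) + ((j : ℝ) + 1)}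

/-- Distance in the grid between two (nonempty) lists of nodes. -/
noncomputable def pathDist (N : ℕ) (P Q : List Node) : ℕ :=
  sInf {d : ℕ | ∃ x ∈ P, ∃ y ∈ Q, d = (grid N).dist x y}

end OnlineGrid

open OnlineGrid

open Filter Asymptotics

/-! The proof has three ingredients.

Forcing potential (`exists_strip_path`). Along a simple path the edge potentials are differences of
a height. To force a drop of `j + 1`, build two gadgets that each force a drop of `j`, so far apart
that the algorithm cannot see their relative position. In a proper coloring the parity of height
plus coordinate sum plus the indicator of color `3` is constant along a path (`IsHeight.parity`).
The determinism of the algorithm gives the colors of the second gadget in advance, and one of two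
consecutive vertical shifts makes the heights of the two upper nodes differ in parity. They are then
unequal, and the higher one lies at least `j + 1` above the lower node of the other gadget. The
width doubles at each level, up to `2T + 2` columns, and the strip grows by one unit in height.
Cutting by the intermediate value theorem gives a path of potential exactly `10T` and some
horizontal span `k`, with `k ^ 2 ≤ 2 ^ (100T)`.

A quiet window of the same span (`exists_window`). A properly colored grid has a global height
(`exists_grid_height`), so the diagonal path has the same potential as `W`, namely `0`. If no window
of span `k` had potential at most `2` in absolute value, all windows would have increments of one
sign and size at least `3`, since the increment changes by at most `4` from one window to the next.
At least `k` disjoint windows then outweigh the fewer than `k` leftover steps of size at most `2`.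

Placement (`exists_reveal_near_diagonal`). `W` and the diagonal path lie, up to rounding, on one
side of the line through `u` and `v`. The gadget is tried out on the other side to learn `k`, hence
the window, and is then revealed in a translated position next to that window. By
`colorAt_translate` its colors are the same there. -/

namespace OnlineGrid

/-! ### The grid distance is the `ℓ¹` distance -/

/-- The `ℓ¹` distance of lattice points. -/
def l1 (z w : Node) : ℕ := (z.1 - w.1).natAbs + (z.2 - w.2).natAbs

lemma l1_triangle (x y z : Node) : l1 x z ≤ l1 x y + l1 y z := by
  unfold l1; omega

lemma l1_comm (x y : Node) : l1 x y = l1 y x := by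
  unfold l1; omega

lemma inGrid_of_adj {N : ℕ} {z w : Node} (h : (grid N).Adj z w) : InGrid N z ∧ InGrid N w := by
  rcases h with h | h | h | h
  exacts [⟨h.1, h.2.1⟩, ⟨h.2.1, h.1⟩, ⟨h.1, h.2.1⟩, ⟨h.2.1, h.1⟩]

lemma grid_adj_iff {N : ℕ} {z w : Node} :
    (grid N).Adj z w ↔ InGrid N z ∧ InGrid N w ∧ l1 z w = 1 := by
  constructor
  · intro h
    refine ⟨(inGrid_of_adj h).1, (inGrid_of_adj h).2, ?_⟩
    unfold l1
    rcases h with h | h | h | h <;> obtain ⟨-, -, h1, h2⟩ := h <;> omega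
  · rintro ⟨hz, hw, h⟩
    unfold l1 at h
    have : (w.1 = z.1 + 1 ∧ w.2 = z.2) ∨ (z.1 = w.1 + 1 ∧ z.2 = w.2) ∨
        (w.1 = z.1 ∧ w.2 = z.2 + 1) ∨ (z.1 = w.1 ∧ z.2 = w.2 + 1) := by omega
    rcases this with h | h | h | h
    · exact Or.inl ⟨hz, hw, h.1, h.2⟩
    · exact Or.inr (Or.inl ⟨hw, hz, h.1, h.2⟩)
    · exact Or.inr (Or.inr (Or.inl ⟨hz, hw, h.1, h.2⟩))
    · exact Or.inr (Or.inr (Or.inr ⟨hw, hz, h.1, h.2⟩))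

lemma l1_le_length {N : ℕ} {z w : Node} (p : (grid N).Walk z w) : l1 z w ≤ p.length := by
  induction p with
  | nil => simp [l1]
  | @cons x y z h p ih =>
    have := (grid_adj_iff.1 h).2.2
    have := l1_triangle x y z
    simp only [SimpleGraph.Walk.length_cons]
    omega

lemma inGrid_of_walk {N : ℕ} {z w : Node} (p : (grid N).Walk z w) (hz : InGrid N z) :
    InGrid N w := by
  induction p with
  | nil => exact hz
  | cons h p ih => exact ih (inGrid_of_adj h).2

lemma exists_walk_length_eq_l1 {N : ℕ} {z w : Node} (hz : InGrid N z) (hw : InGrid N w) :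
    ∃ p : (grid N).Walk z w, p.length = l1 z w := by
  induction hn : l1 z w generalizing z with
  | zero =>
    have : z = w := by
      unfold l1 at hn
      ext <;> omega
    subst this
    exact ⟨.nil, rfl⟩
  | succ n ih =>
    obtain ⟨z', hz', h1, h2⟩ : ∃ z', InGrid N z' ∧ l1 z z' = 1 ∧ l1 z' w = n := by
      unfold l1 at *
      unfold InGrid at *
      by_cases a : z.1 < w.1
      · exact ⟨(z.1 + 1, z.2), by dsimp only; omega⟩
      by_cases b : w.1 < z.1
      · exact ⟨(z.1 - 1, z.2), by dsimp only; omega⟩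
      by_cases c : z.2 < w.2
      · exact ⟨(z.1, z.2 + 1), by dsimp only; omega⟩
      · exact ⟨(z.1, z.2 - 1), by dsimp only; omega⟩
    obtain ⟨p, hp⟩ := ih hz' h2
    exact ⟨.cons (grid_adj_iff.2 ⟨hz, hz', h1⟩) p, by simp [hp]⟩

lemma edist_eq_l1 {N : ℕ} {z w : Node} (hz : InGrid N z) (hw : InGrid N w) :
    (grid N).edist z w = l1 z w := by
  obtain ⟨p, hp⟩ := exists_walk_length_eq_l1 hz hw
  apply le_antisymm
  · rw [← hp]; exact SimpleGraph.edist_le p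
  · obtain ⟨q, hq⟩ := p.reachable.exists_walk_length_eq_edist
    rw [← hq]
    exact_mod_cast l1_le_length q

lemma dist_eq_l1 {N : ℕ} {z w : Node} (hz : InGrid N z) (hw : InGrid N w) :
    (grid N).dist z w = l1 z w := by
  unfold SimpleGraph.dist
  rw [edist_eq_l1 hz hw]; rfl

/-! ### Views and translations -/

lemma mem_view {N T : ℕ} {l : List Node} (hl : ∀ z ∈ l, InGrid N z) {w : Node} :
    w ∈ view N T l ↔ InGrid N w ∧ ∃ v ∈ l, l1 v w ≤ T := by
  constructor
  · rintro ⟨v, hv, h⟩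
    have hr : (grid N).Reachable v w := by
      by_contra hr
      rw [SimpleGraph.edist_eq_top_of_not_reachable hr] at h
      exact absurd h (by simp)
    obtain ⟨p⟩ := hr
    have hw := inGrid_of_walk p (hl v hv)
    refine ⟨hw, v, hv, ?_⟩
    rw [edist_eq_l1 (hl v hv) hw] at h
    exact_mod_cast h
  · rintro ⟨hw, v, hv, h⟩
    refine ⟨v, hv, ?_⟩
    rw [edist_eq_l1 (hl v hv) hw]
    exact_mod_cast h

/-- `z` is so far from the boundary of the grid that its `T`-ball is complete, and its `T`-ball is
neither met by nor adjacent to the `T`-balls around the nodes in `H`. -/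
def Safe (N T : ℕ) (H : List Node) (z : Node) : Prop :=
  ((T : ℤ) + 1 ≤ z.1 ∧ z.1 + T ≤ N ∧ (T : ℤ) + 1 ≤ z.2 ∧ z.2 + T ≤ N) ∧
    ∀ w ∈ H, 2 * T + 2 ≤ l1 z w

lemma Safe.inGrid {N T : ℕ} {H : List Node} {z : Node} (h : Safe N T H z) : InGrid N z := by
  have := h.1
  unfold InGrid; omega

lemma Safe.notMem {N T : ℕ} {H : List Node} {z : Node} (h : Safe N T H z) : z ∉ H := by
  intro hz
  have := h.2 z hz
  unfold l1 at this; omega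

lemma Safe.inGrid_of_l1_le {N T : ℕ} {H : List Node} {z w : Node} (h : Safe N T H z)
    (hw : l1 z w ≤ T) : InGrid N w := by
  have := h.1
  unfold l1 at hw
  unfold InGrid; omega

lemma l1_add (z w t : Node) : l1 (z + t) (w + t) = l1 z w := by
  unfold l1; simp

/-- Complete `T`-balls that are neither met by nor adjacent to the old view form a separate piece of
the seen graph, in both positions. The whole piece can therefore be moved while the old view stays
fixed. -/
lemma sameView_translate {N T : ℕ} {H τ : List Node} (t : Node) (hH : ∀ z ∈ H, InGrid N z)
    (h1 : ∀ z ∈ τ, Safe N T H z) (h2 : ∀ z ∈ τ, Safe N T H (z + t)) :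
    SameView N T (H ++ τ) (H ++ τ.map (· + t)) := by
  classical
  have hτ : ∀ z ∈ H ++ τ, InGrid N z := by
    intro z hz
    rcases List.mem_append.1 hz with h | h
    exacts [hH z h, (h1 z h).inGrid]
  have hτ' : ∀ z ∈ H ++ τ.map (· + t), InGrid N z := by
    intro z hz
    rcases List.mem_append.1 hz with h | h
    · exact hH z h
    · obtain ⟨y, hy, rfl⟩ := List.mem_map.1 h
      exact (h2 y hy).inGrid
  have key : ∀ w, w ∈ view N T (H ++ τ) ↔ w ∈ view N T H ∨ ∃ z ∈ τ, l1 z w ≤ T := by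
    intro w
    rw [mem_view hτ, mem_view hH]
    constructor
    · rintro ⟨hw, v, hv, h⟩
      rcases List.mem_append.1 hv with h' | h'
      exacts [Or.inl ⟨hw, v, h', h⟩, Or.inr ⟨v, h', h⟩]
    · rintro (⟨hw, v, hv, h⟩ | ⟨v, hv, h⟩)
      · exact ⟨hw, v, List.mem_append_left _ hv, h⟩
      · exact ⟨(h1 v hv).inGrid_of_l1_le h, v, List.mem_append_right _ hv, h⟩
  have key' : ∀ w, w ∈ view N T (H ++ τ.map (· + t)) ↔
      w ∈ view N T H ∨ ∃ z ∈ τ, l1 (z + t) w ≤ T := by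
    intro w
    rw [mem_view hτ', mem_view hH]
    constructor
    · rintro ⟨hw, v, hv, h⟩
      rcases List.mem_append.1 hv with h' | h'
      · exact Or.inl ⟨hw, v, h', h⟩
      · obtain ⟨y, hy, rfl⟩ := List.mem_map.1 h'
        exact Or.inr ⟨y, hy, h⟩
    · rintro (⟨hw, v, hv, h⟩ | ⟨v, hv, h⟩)
      · exact ⟨hw, v, List.mem_append_left _ hv, h⟩
      · exact ⟨(h2 v hv).inGrid_of_l1_le h, v + t,
          List.mem_append_right _ (List.mem_map.2 ⟨v, hv, rfl⟩), h⟩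
  -- Centers at distance `2T + 2` leave distance at least `2` between points of their `T`-balls, so
  -- the balls are disjoint and no edge joins them.
  have far : ∀ a ∈ view N T H, ∀ z ∈ τ, ∀ b, l1 z b ≤ T → 2 ≤ l1 a b := by
    intro a ha z hz b hb
    obtain ⟨-, v, hv, hva⟩ := (mem_view hH).1 ha
    have := (h1 z hz).2 v hv
    unfold l1 at *; omega
  have far' : ∀ a ∈ view N T H, ∀ z ∈ τ, ∀ b, l1 (z + t) b ≤ T → 2 ≤ l1 a b := by
    intro a ha z hz b hb
    obtain ⟨-, v, hv, hva⟩ := (mem_view hH).1 ha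
    have := (h2 z hz).2 v hv
    have := l1_triangle (z + t) b v
    have := l1_triangle b a v
    have := l1_comm a b
    have := l1_comm a v
    omega
  have out : ∀ z ∈ τ, ∀ b, l1 z b ≤ T → b ∉ view N T H := by
    intro z hz b hb hb'
    have := far b hb' z hz b hb
    unfold l1 at this; omega
  have out' : ∀ z ∈ τ, ∀ b, l1 (z + t) b ≤ T → b ∉ view N T H := by
    intro z hz b hb hb'
    have := far' b hb' z hz b hb
    unfold l1 at this; omega
  have noE : ∀ a b, 2 ≤ l1 a b → ¬ East N a b ∧ ¬ North N a b ∧ ¬ East N b a ∧ ¬ North N b a := by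
    intro a b h
    unfold l1 at h
    refine ⟨?_, ?_, ?_, ?_⟩ <;> rintro ⟨-, -, h1, h2⟩ <;> omega
  refine ⟨fun w => if w ∈ view N T H then w else w + t, ⟨?_, ?_, ?_⟩, ?_, ?_⟩
  · intro w hw
    rcases (key w).1 hw with h | ⟨z, hz, h⟩
    · simp only [h, if_true]
      exact (key' w).2 (Or.inl h)
    · simp only [out z hz w h, if_false]
      exact (key' _).2 (Or.inr ⟨z, hz, by rwa [l1_add]⟩)
  · intro a ha b hb hab
    rcases (key a).1 ha with h | ⟨z, hz, h⟩ <;> rcases (key b).1 hb with h' | ⟨z', hz', h'⟩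
    · simpa only [h, h', if_true] using hab
    · simp only [h, out z' hz' b h', if_true, if_false] at hab
      exact absurd (hab ▸ h) (out' z' hz' _ (by rwa [l1_add]))
    · simp only [h', out z hz a h, if_true, if_false] at hab
      exact absurd (hab ▸ h') (out' z hz _ (by rwa [l1_add]))
    · simpa only [out z hz a h, out z' hz' b h', if_false, add_left_inj] using hab
  · intro w hw
    rcases (key' w).1 hw with h | ⟨z, hz, h⟩
    · exact ⟨w, (key w).2 (Or.inl h), by simp only [h, if_true]⟩
    · have h' : l1 z (w - t) ≤ T := by
        rw [← l1_add z (w - t) t, sub_add_cancel]; exact h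
      refine ⟨w - t, (key _).2 (Or.inr ⟨z, hz, h'⟩), ?_⟩
      simp only [out z hz _ h', if_false, sub_add_cancel]
  · rw [List.map_append]
    congr 1
    · conv_rhs => rw [← List.map_id H]
      apply List.map_congr_left
      intro z hz
      have : z ∈ view N T H := (mem_view hH).2 ⟨hH z hz, z, hz, by simp [l1]⟩
      simp only [this, if_true, id]
    · apply List.map_congr_left
      intro z hz
      simp only [out z hz z (by simp [l1]), if_false]
  · intro a ha b hb
    rcases (key a).1 ha with h | ⟨z, hz, h⟩ <;> rcases (key b).1 hb with h' | ⟨z', hz', h'⟩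
    · simp only [h, h', if_true, and_self]
    · simp only [h, out z' hz' b h', if_true, if_false]
      have e1 := noE _ _ (far a h z' hz' b h')
      have e2 := noE _ _ (far' a h z' hz' (b + t) (by rwa [l1_add]))
      tauto
    · simp only [h', out z hz a h, if_true, if_false]
      have e1 := noE _ _ (far b h' z hz a h)
      have e2 := noE _ _ (far' b h' z hz (a + t) (by rwa [l1_add]))
      tauto
    · simp only [out z hz a h, out z' hz' b h', if_false]
      have g1 := (h1 z hz).inGrid_of_l1_le h
      have g2 := (h1 z' hz').inGrid_of_l1_le h'
      have g3 := (h2 z hz).inGrid_of_l1_le (w := a + t) (by rwa [l1_add])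
      have g4 := (h2 z' hz').inGrid_of_l1_le (w := b + t) (by rwa [l1_add])
      simp only [East, North, g1, g2, g3, g4, true_and, Prod.fst_add, Prod.snd_add]
      constructor <;> constructor <;> rintro ⟨h1, h2⟩ <;> constructor <;> omega

lemma colorAt_append_left {N T : ℕ} (A : OnlineLocalAlg N T) {l : List Node} (l' : List Node)
    {z : Node} (hz : z ∈ l) : A.colorAt (l ++ l') z = A.colorAt l z := by
  unfold OnlineLocalAlg.colorAt
  rw [List.idxOf_append_of_mem hz, List.take_append_of_le_length]
  exact List.idxOf_lt_length_iff.2 hz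

/-- A color depends only on the initial segment of the sequence up to the node, and
`sameView_translate` applies to each such segment. -/
lemma colorAt_translate {N T : ℕ} (A : OnlineLocalAlg N T) {H τ : List Node} (t : Node)
    (hH : ∀ z ∈ H, InGrid N z) (h1 : ∀ z ∈ τ, Safe N T H z) (h2 : ∀ z ∈ τ, Safe N T H (z + t))
    {z : Node} (hz : z ∈ τ) :
    A.colorAt (H ++ τ.map (· + t)) (z + t) = A.colorAt (H ++ τ) z := by
  unfold OnlineLocalAlg.colorAt
  have inj : Function.Injective (fun w : Node => w + t) := add_left_injective t
  have hidx : (τ.map (· + t)).idxOf (z + t) = τ.idxOf z := by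
    clear h1 h2 hz
    induction τ with
    | nil => rfl
    | cons a τ ih =>
      rw [List.map_cons, List.idxOf_cons, List.idxOf_cons, ih]
      by_cases h : a = z
      · simp [h]
      · have h3 : (a == z) = false := by simpa using h
        have h4 : (a + t == z + t) = false := by simpa using h
        rw [h3, h4]
  rw [List.idxOf_append_of_notMem (h1 z hz).notMem, List.idxOf_append_of_notMem (h2 z hz).notMem,
    hidx, add_assoc, List.take_length_add_append, List.take_length_add_append, List.map_take.symm]
  have m1 : ∀ {y}, y ∈ τ.take (τ.idxOf z + 1) → y ∈ τ := fun h => List.mem_of_mem_take h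
  symm
  apply A.label_eq
  · intro y hy
    rcases List.mem_append.1 hy with h | h
    exacts [hH y h, (h1 y (m1 h)).inGrid]
  · intro y hy
    rcases List.mem_append.1 hy with h | h
    · exact hH y h
    · obtain ⟨x, hx, rfl⟩ := List.mem_map.1 h
      exact (h2 x (m1 hx)).inGrid
  · exact sameView_translate t hH (fun y hy => h1 y (m1 hy)) (fun y hy => h2 y (m1 hy))

/-! ### Heights along a list of nodes -/

lemma edgePotential_symm (c : Node → Fin 3) (z w : Node) :
    edgePotential c w z = - edgePotential c z w := by
  unfold edgePotential
  by_cases h1 : c z ≠ 2 <;> by_cases h2 : c w ≠ 2 <;> simp [h1, h2]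

lemma abs_edgePotential_le (c : Node → Fin 3) (z w : Node) : |edgePotential c z w| ≤ 1 := by
  unfold edgePotential
  generalize c z = a
  generalize c w = b
  revert a b; decide

/-- `h` is a height function for the coloring `c` along the list `L`: the potential of an edge is
the difference of the heights. -/
def IsHeight (c : Node → Fin 3) (h : Node → ℤ) (L : List Node) : Prop :=
  L.IsChain fun a b => edgePotential c a b = h a - h b

lemma isChain_eq_of_mem {α β : Type*} {f : α → β} {L : List α}
    (hL : L.IsChain fun a b => f a = f b) {x y : α} (hx : x ∈ L) (hy : y ∈ L) : f x = f y := by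
  have key : ∀ (L : List α) (a : α), (a :: L).IsChain (fun a b => f a = f b) →
      ∀ x ∈ a :: L, f x = f a := by
    intro L
    induction L with
    | nil => intro a _ x hx; rw [List.mem_singleton.1 hx]
    | cons b L ih =>
      intro a h x hx
      rw [List.isChain_cons_cons] at h
      rcases List.mem_cons.1 hx with rfl | hx
      · rfl
      · rw [ih b h.2 x hx, h.1]
  cases L with
  | nil => simp at hx
  | cons a L => rw [key L a hL x hx, key L a hL y hy]

lemma isChain_and {α : Type*} {R S : α → α → Prop} {L : List α} (h1 : L.IsChain R)
    (h2 : L.IsChain S) : L.IsChain fun a b => R a b ∧ S a b := by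
  induction L with
  | nil => simp
  | cons a L ih =>
    cases L with
    | nil => simp
    | cons b L =>
      rw [List.isChain_cons_cons] at *
      exact ⟨⟨h1.1, h2.1⟩, ih h1.2 h2.2⟩

lemma isChain_imp_of_mem {α : Type*} {R S : α → α → Prop} {L : List α} (h : L.IsChain R)
    (H : ∀ a ∈ L, ∀ b ∈ L, R a b → S a b) : L.IsChain S := by
  induction L with
  | nil => simp
  | cons a L ih =>
    cases L with
    | nil => simp
    | cons b L =>
      rw [List.isChain_cons_cons] at *
      exact ⟨H a (by simp) b (by simp) h.1,
        ih h.2 fun x hx y hy => H x (List.mem_cons_of_mem _ hx) y (List.mem_cons_of_mem _ hy)⟩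

/-- Heights along one path differ by a constant, so drops may be computed with any one of them. -/
lemma IsHeight.sub_eq_sub {c : Node → Fin 3} {h h' : Node → ℤ} {L : List Node}
    (H : IsHeight c h L) (H' : IsHeight c h' L) {x y : Node} (hx : x ∈ L) (hy : y ∈ L) :
    h x - h y = h' x - h' y := by
  have := isChain_eq_of_mem (f := fun z => h z - h' z)
    ((isChain_and H H').imp fun a b hab => by have := hab.1; have := hab.2; omega) hx hy
  omega

lemma IsHeight.congr {c c' : Node → Fin 3} {h h' : Node → ℤ} {L : List Node}
    (H : IsHeight c h L) (hc : ∀ z ∈ L, c z = c' z) (hh : ∀ z ∈ L, h z = h' z) :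
    IsHeight c' h' L := by
  refine isChain_imp_of_mem H fun a ha b hb hab => ?_
  unfold edgePotential at *
  rw [← hc a ha, ← hc b hb, ← hh a ha, ← hh b hb]
  exact hab

/-- Values can be assigned node by node because none repeats. The coloring need not be proper or
extend to the grid, which matters for the forced gadgets. -/
lemma exists_isHeight (c : Node → Fin 3) {L : List Node} (hL : L.Nodup) :
    ∃ h, IsHeight c h L := by
  induction L with
  | nil => exact ⟨fun _ => 0, by simp [IsHeight]⟩
  | cons a L ih =>
    obtain ⟨h, hh⟩ := ih hL.of_cons
    cases L with
    | nil => exact ⟨h, by simp [IsHeight]⟩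
    | cons b L =>
      have ha : a ∉ b :: L := (List.nodup_cons.1 hL).1
      refine ⟨fun z => if z = a then h b + edgePotential c a b else h z, ?_⟩
      have hb : b ≠ a := fun e => ha (by simp [e])
      refine List.isChain_cons_cons.2 ⟨by simp [hb], ?_⟩
      refine IsHeight.congr hh (fun _ _ => rfl) fun z hz => ?_
      have : z ≠ a := fun e => ha (e ▸ hz)
      simp [this]

lemma IsHeight.potential_eq {c : Node → Fin 3} {h : Node → ℤ} {L : List Node}
    (H : IsHeight c h L) {a b : Node} (ha : L.head? = some a) (hb : L.getLast? = some b) :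
    potential c L = h a - h b := by
  induction L generalizing a with
  | nil => simp at ha
  | cons x L ih =>
    obtain rfl : x = a := by simpa using ha
    cases L with
    | nil =>
      obtain rfl : x = b := by simpa using hb
      simp [potential]
    | cons y L =>
      have H' := List.isChain_cons_cons.1 H
      rw [potential, ih H'.2 rfl (by simpa using hb), H'.1]
      ring

lemma potential_congr {c c' : Node → Fin 3} {L : List Node} (hc : ∀ z ∈ L, c z = c' z) :
    potential c L = potential c' L := by
  induction L with
  | nil => rfl
  | cons x L ih =>
    cases L with
    | nil => rfl
    | cons y L =>
      rw [potential, potential, ih fun z hz => hc z (List.mem_cons_of_mem _ hz)]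
      unfold edgePotential
      rw [hc x (by simp), hc y (by simp)]

/-- On a properly colored edge either exactly one end has the special color and the potential is
`0`, or neither has and the potential is `±1`. So potential plus indicators is odd, and so is the
change of the coordinate sum. -/
lemma IsHeight.parity {c : Node → Fin 3} {h : Node → ℤ} {L : List Node} (H : IsHeight c h L)
    (hadj : L.IsChain fun a b => l1 a b = 1) (hc : L.IsChain fun a b => c a ≠ c b)
    {x y : Node} (hx : x ∈ L) (hy : y ∈ L) :
    (h x + (if c x = 2 then 1 else 0) + x.1 + x.2) % 2 =
      (h y + (if c y = 2 then 1 else 0) + y.1 + y.2) % 2 := by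
  refine isChain_eq_of_mem
    (f := fun x => (h x + (if c x = 2 then 1 else 0) + x.1 + x.2) % 2) ?_ hx hy
  refine (isChain_and H (isChain_and hadj hc)).imp ?_
  rintro a b ⟨h1, h2, h3⟩
  have h4 : (edgePotential c a b + (if c a = 2 then 1 else 0) + (if c b = 2 then 1 else 0)) % 2
      = 1 := by
    unfold edgePotential
    generalize c a = s at *
    generalize c b = t at *
    clear h1
    revert s t; decide
  unfold l1 at h2
  generalize (if c a = 2 then (1 : ℤ) else 0) = s at *
  generalize (if c b = 2 then (1 : ℤ) else 0) = t at *
  omega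

/-! ### Cutting paths of prescribed potential out of longer paths. -/

lemma isChain_reverse {α : Type*} {R : α → α → Prop} (hR : ∀ a b, R a b → R b a) {L : List α}
    (h : L.IsChain R) : L.reverse.IsChain R :=
  List.isChain_reverse.2 (h.imp fun a b hab => hR a b hab)

/-- A path that contains `p` and `q` contains a path from `p` to `q`. -/
lemma exists_slice {α : Type*} {R : α → α → Prop} (hR : ∀ a b, R a b → R b a) {L : List α}
    (h : L.IsChain R) (hn : L.Nodup) {p q : α} (hp : p ∈ L) (hq : q ∈ L) :
    ∃ S : List α, S.IsChain R ∧ S.Nodup ∧ (∀ z ∈ S, z ∈ L) ∧ S.head? = some p ∧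
      S.getLast? = some q := by
  have key : ∀ L : List α, L.IsChain R → L.Nodup → ∀ X Y, L = X ++ p :: Y → q ∈ p :: Y →
      ∃ S : List α, S.IsChain R ∧ S.Nodup ∧ (∀ z ∈ S, z ∈ L) ∧ S.head? = some p ∧
        S.getLast? = some q := by
    intro L h hn X Y hL hq
    obtain ⟨X', Y', e⟩ := List.append_of_mem hq
    have e2 : L = X ++ ((X' ++ [q]) ++ Y') := by simp [hL, e]
    have hi : (X' ++ [q]) <:+: L := ⟨X, Y', by simp [e2]⟩
    refine ⟨X' ++ [q], h.infix hi, hi.sublist.nodup hn, fun z hz => hi.subset hz, ?_, by simp⟩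
    cases X' with
    | nil => simp at e; simp [e.1]
    | cons x X' => simp at e; simp [e.1]
  obtain ⟨X, Y, e⟩ := List.append_of_mem hp
  by_cases hq' : q ∈ p :: Y
  · exact key L h hn X Y e hq'
  · have hqX : q ∈ X := by
      rw [e] at hq
      exact (List.mem_append.1 hq).resolve_right hq'
    obtain ⟨S, h1, h2, h3, h4⟩ := key L.reverse (isChain_reverse hR h) (List.nodup_reverse.2 hn)
      Y.reverse X.reverse (by simp [e]) (by simp [hqX])
    exact ⟨S, h1, h2, fun z hz => List.mem_reverse.1 (h3 z hz), h4⟩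

/-- Discrete intermediate value theorem along a path. -/
lemma exists_prefix_height {h : Node → ℤ} {p : Node} {J : ℤ} (S : List Node)
    (hS : S.IsChain fun a b => |h a - h b| ≤ 1) (hp : S.head? = some p) (h0 : J ≤ h p)
    {q : Node} (hq : q ∈ S) (hJ : h q ≤ J) :
    ∃ S', S' <+: S ∧ S'.head? = some p ∧ ∃ z, S'.getLast? = some z ∧ h z = J := by
  induction S generalizing p with
  | nil => simp at hp
  | cons a S ih =>
    obtain rfl : a = p := by simpa using hp
    by_cases e : h a = J
    · exact ⟨[a], ⟨S, rfl⟩, rfl, a, rfl, e⟩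
    · have hqa : q ≠ a := by rintro rfl; omega
      have hqS : q ∈ S := (List.mem_cons.1 hq).resolve_left hqa
      cases S with
      | nil => simp at hqS
      | cons b S =>
        rw [List.isChain_cons_cons] at hS
        have h1 := abs_le.1 hS.1
        obtain ⟨S', h2, h3, z, h4, h5⟩ := ih hS.2 rfl (by omega) hqS
        refine ⟨a :: S', List.cons_prefix_cons.2 ⟨rfl, h2⟩, rfl, z, ?_, h5⟩
        cases S' with
        | nil => simp at h3
        | cons => simpa using h4

/-- From a path along which the height drops by `J` or more one can cut out a path of potential
exactly `J`. -/
lemma exists_path_potential_eq {c : Node → Fin 3} {h : Node → ℤ} {L : List Node}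
    (hh : IsHeight c h L) (hn : L.Nodup) (hadj : L.IsChain fun a b => l1 a b = 1)
    {p q : Node} (hp : p ∈ L) (hq : q ∈ L) {J : ℤ} (hJ : 0 ≤ J) (hpq : J ≤ h p - h q) :
    ∃ (R : List Node) (z : Node), R.IsChain (fun a b => l1 a b = 1) ∧ R.Nodup ∧
      (∀ x ∈ R, x ∈ L) ∧ R.head? = some p ∧ R.getLast? = some z ∧ potential c R = J := by
  obtain ⟨S, h1, h2, h3, h4, h5⟩ := exists_slice
    (R := fun a b => edgePotential c a b = h a - h b ∧ l1 a b = 1)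
    (fun a b hab => ⟨by rw [edgePotential_symm, hab.1]; ring, by rw [l1_comm, hab.2]⟩)
    (isChain_and hh hadj) hn hp hq
  obtain ⟨S', g1, g2, z, g3, g4⟩ := exists_prefix_height (h := h) (J := h p - J) S
    (h1.imp fun a b hab => by rw [← hab.1]; exact abs_edgePotential_le c a b) h4 (by omega)
    (List.mem_of_getLast? h5) (by omega)
  have h6 := h1.infix g1.isInfix
  refine ⟨S', z, h6.imp fun a b hab => hab.2, g1.sublist.nodup h2,
    fun x hx => h3 x (g1.subset hx), g2, g3, ?_⟩
  rw [IsHeight.potential_eq (h6.imp fun a b hab => hab.1) g2 g3, g4]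
  ring

/-! ### Paths of lattice points -/

/-- `L` is a simple path of lattice points from `a` to `b`. -/
def PathFromTo (L : List Node) (a b : Node) : Prop :=
  L.IsChain (fun a b => l1 a b = 1) ∧ L.Nodup ∧ L.head? = some a ∧ L.getLast? = some b

lemma PathFromTo.append {P Q : List Node} {a b c d : Node} (hP : PathFromTo P a b)
    (hQ : PathFromTo Q c d) (hbc : l1 b c = 1) (hd : ∀ z ∈ P, z ∉ Q) :
    PathFromTo (P ++ Q) a d := by
  obtain ⟨h1, h2, h3, h4⟩ := hP
  obtain ⟨g1, g2, g3, g4⟩ := hQ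
  refine ⟨List.isChain_append.2 ⟨h1, g1, ?_⟩, ?_, ?_, ?_⟩
  · intro x hx y hy
    rw [h4, Option.mem_some_iff] at hx
    rw [g3, Option.mem_some_iff] at hy
    rw [← hx, ← hy]; exact hbc
  · exact List.nodup_append'.2 ⟨h2, g2, fun z hz hz' => hd z hz hz'⟩
  · rw [List.head?_append, h3]; rfl
  · rw [List.getLast?_append, g4]; rfl

lemma PathFromTo.translate {P : List Node} {a b : Node} (hP : PathFromTo P a b) (t : Node) :
    PathFromTo (P.map (· + t)) (a + t) (b + t) := by
  obtain ⟨h1, h2, h3, h4⟩ := hP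
  refine ⟨?_, h2.map (add_left_injective t), by simp [h3], by simp [h4]⟩
  rw [List.isChain_map]
  exact h1.imp fun a b hab => by rw [l1_add, hab]

lemma PathFromTo.last_mem {P : List Node} {a b : Node} (hP : PathFromTo P a b) : b ∈ P :=
  List.mem_of_getLast? hP.2.2.2

lemma pathFromTo_singleton (a : Node) : PathFromTo [a] a a := by
  refine ⟨by simp, by simp, rfl, rfl⟩

lemma exists_vertical_path (x y y' : ℤ) : ∃ L, PathFromTo L (x, y) (x, y') ∧
    ∀ z ∈ L, z.1 = x ∧ min y y' ≤ z.2 ∧ z.2 ≤ max y y' := by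
  induction hn : (y - y').natAbs generalizing y with
  | zero =>
    obtain rfl : y = y' := by omega
    exact ⟨[(x, y)], pathFromTo_singleton _, by simp⟩
  | succ n ih =>
    obtain ⟨y₁, h1, h2, h3, h4, h5⟩ : ∃ y₁ : ℤ, (y₁ - y').natAbs = n ∧ (y - y₁).natAbs = 1 ∧
        min y y' ≤ min y₁ y' ∧ max y₁ y' ≤ max y y' ∧ (y < min y₁ y' ∨ max y₁ y' < y) := by
      rcases lt_or_ge y y' with h | h
      · exact ⟨y + 1, by omega⟩
      · exact ⟨y - 1, by omega⟩
    obtain ⟨L, hL, hb⟩ := ih y₁ h1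
    refine ⟨[(x, y)] ++ L, (pathFromTo_singleton _).append hL (by simp [l1, h2]) ?_, ?_⟩
    · intro z hz hz'
      obtain rfl : z = (x, y) := by simpa using hz
      have := hb _ hz'
      dsimp only at this; omega
    · intro z hz
      rcases List.mem_append.1 hz with h | h
      · obtain rfl : z = (x, y) := by simpa using h
        dsimp only; omega
      · have := hb _ h
        omega

/-- Signed height of a lattice point over the line of slope `m` through the origin. -/
noncomputable def lineHeight (m : ℝ) (z : Node) : ℝ := (z.2 : ℝ) - m * (z.1 : ℝ)

lemma exists_node_of_lineHeight (m s : ℝ) (X : ℤ) :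
    ∃ q : Node, q.1 = X ∧ s - 1 ≤ lineHeight m q ∧ lineHeight m q ≤ s := by
  have h1 := Int.lt_floor_add_one (s + m * X)
  have h2 := Int.floor_le (s + m * X)
  refine ⟨(X, ⌊s + m * X⌋), rfl, ?_, ?_⟩ <;> simp only [lineHeight] <;> linarith

/-- In each column move vertically to the node just below line height `c`, hence in `(c - 1, c]`,
then step east, which changes the line height by at most `1`. This is why the strip must contain `[c
- 2, c + 1]`. Columns are never revisited, so the path is simple. -/
lemma exists_path_in_strip {m c lo hi : ℝ} (hm : |m| ≤ 1) (hlo : lo ≤ c - 2) (hhi : c + 1 ≤ hi)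
    (n : ℕ) (x y y' : ℤ) (h1 : lo ≤ lineHeight m (x, y)) (h2 : lineHeight m (x, y) ≤ hi)
    (h3 : lo ≤ lineHeight m (x + n, y')) (h4 : lineHeight m (x + n, y') ≤ hi) :
    ∃ L, PathFromTo L (x, y) (x + n, y') ∧
      ∀ z ∈ L, x ≤ z.1 ∧ z.1 ≤ x + n ∧ lo ≤ lineHeight m z ∧ lineHeight m z ≤ hi := by
  have vert : ∀ x y y' : ℤ, lo ≤ lineHeight m (x, y) → lineHeight m (x, y) ≤ hi →
      lo ≤ lineHeight m (x, y') → lineHeight m (x, y') ≤ hi →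
      ∃ L, PathFromTo L (x, y) (x, y') ∧
        ∀ z ∈ L, z.1 = x ∧ lo ≤ lineHeight m z ∧ lineHeight m z ≤ hi := by
    intro x y y' h1 h2 h3 h4
    obtain ⟨L, hL, hb⟩ := exists_vertical_path x y y'
    refine ⟨L, hL, fun z hz => ?_⟩
    obtain ⟨e, h5, h6⟩ := hb z hz
    simp only [lineHeight] at *
    rw [e]
    have h7 : (y : ℝ) ≤ z.2 ∨ (y' : ℝ) ≤ z.2 := by
      rcases min_le_iff.1 h5 with h | h
      exacts [Or.inl (by exact_mod_cast h), Or.inr (by exact_mod_cast h)]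
    have h8 : (z.2 : ℝ) ≤ y ∨ (z.2 : ℝ) ≤ y' := by
      rcases le_max_iff.1 h6 with h | h
      exacts [Or.inl (by exact_mod_cast h), Or.inr (by exact_mod_cast h)]
    refine ⟨rfl, ?_, ?_⟩
    · rcases h7 with h | h <;> linarith
    · rcases h8 with h | h <;> linarith
  induction n generalizing x y with
  | zero =>
    simp only [Nat.cast_zero, add_zero] at *
    obtain ⟨L, hL, hb⟩ := vert x y y' h1 h2 h3 h4
    refine ⟨L, hL, fun z hz => ?_⟩
    obtain ⟨e, h⟩ := hb z hz
    exact ⟨by omega, by omega, h⟩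
  | succ n ih =>
    have hm' := abs_le.1 hm
    have f1 := Int.floor_le (c + m * x)
    have f2 := Int.lt_floor_add_one (c + m * x)
    generalize ⌊c + m * x⌋ = w at f1 f2
    obtain ⟨L, hL, hb⟩ := vert x y w h1 h2 (by simp only [lineHeight]; linarith)
      (by simp only [lineHeight]; linarith)
    have e : x + 1 + (n : ℤ) = x + ((n + 1 : ℕ) : ℤ) := by push_cast; ring
    obtain ⟨L', hL', hb'⟩ := ih (x + 1) w
      (by simp only [lineHeight]; push_cast; linarith)
      (by simp only [lineHeight]; push_cast; linarith) (by rw [e]; exact h3) (by rw [e]; exact h4)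
    rw [e] at hL' hb'
    refine ⟨L ++ L', hL.append hL' (by simp [l1]) ?_, ?_⟩
    · intro z hz hz'
      have := (hb z hz).1
      have := (hb' z hz').1
      omega
    · intro z hz
      rcases List.mem_append.1 hz with h | h
      · obtain ⟨e, h⟩ := hb z h
        exact ⟨by omega, by omega, h⟩
      · obtain ⟨e, h⟩ := hb' z h
        exact ⟨by omega, h⟩

/-! ### The recursive construction -/

/-- Width of the strip that is needed to force potential `j` on an algorithm of locality `T`. -/
def stripWidth (T : ℕ) : ℕ → ℕ
  | 0 => 0
  | j + 1 => 2 * stripWidth T j + (2 * T + 2)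

/-- No two adjacent nodes in `τ` have the same color. -/
def ProperOn (c : Node → Fin 3) (τ : List Node) : Prop :=
  ∀ z ∈ τ, ∀ w ∈ τ, l1 z w = 1 → c z ≠ c w

/-- Suppose that the nodes of `H` have been revealed. By revealing nodes in a strip of slope `m`
around `p`, the adversary can force a path along which the height drops by `j`, or an edge whose
ends have the same color. -/
theorem exists_strip_path {N T : ℕ} (A : OnlineLocalAlg N T) {m : ℝ} (hm : |m| ≤ 1) (j : ℕ) :
    ∀ (H : List Node) (p : Node), (∀ z ∈ H, InGrid N z) →
    (∀ z : Node, p.1 ≤ z.1 → z.1 ≤ p.1 + stripWidth T j →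
      |lineHeight m z - lineHeight m p| ≤ j + 1 → Safe N T H z) →
    ∃ (τ L : List Node) (b : ℝ) (B x y : Node), τ.Nodup ∧ PathFromTo L p B ∧ (∀ z ∈ L, z ∈ τ) ∧
      (∀ z ∈ τ, p.1 ≤ z.1 ∧ z.1 ≤ B.1 ∧ b - 1 ≤ lineHeight m z ∧ lineHeight m z ≤ b + j + 1) ∧
      lineHeight m p - j ≤ b ∧ b ≤ lineHeight m p ∧ b ≤ lineHeight m B ∧
      lineHeight m B ≤ b + j ∧ B.1 ≤ p.1 + stripWidth T j ∧ x ∈ L ∧ y ∈ L ∧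
      (ProperOn (A.colorAt (H ++ τ)) τ →
        ∀ h, IsHeight (A.colorAt (H ++ τ)) h L → (j : ℤ) ≤ h x - h y) := by
  induction j with
  | zero =>
    intro H p _ _
    refine ⟨[p], [p], lineHeight m p, p, p, p, by simp, pathFromTo_singleton p, by simp, ?_,
      by simp, le_rfl, le_rfl, by simp, by simp [stripWidth], by simp, by simp, by simp⟩
    simp only [List.mem_singleton, forall_eq, le_refl, true_and, Nat.cast_zero]
    constructor <;> linarith
  | succ j ih =>
    intro H p hH hs
    have hw : (stripWidth T (j + 1) : ℤ) = 2 * stripWidth T j + (2 * T + 2) := by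
      simp [stripWidth]
    have hm' := abs_le.1 hm
    push_cast at hs ⊢
    -- the first copy
    obtain ⟨τ₁, L₁, b₁, B₁, x₁, y₁, hn₁, hL₁, hLτ₁, hτ₁, hb₁, hb₁', hB₁, hB₁', hBw₁, hx₁, hy₁,
      hp₁⟩ := ih H p hH fun z h1 h2 h3 => hs z h1 (by omega) (by linarith)
    have hst₁ : ∀ z ∈ τ₁, Safe N T H z := by
      intro z hz
      obtain ⟨h1, h2, h3, h4⟩ := hτ₁ z hz
      exact hs z h1 (by omega) (abs_le.2 ⟨by linarith, by linarith⟩)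
    have hH₁ : ∀ z ∈ H ++ τ₁, InGrid N z := by
      intro z hz
      rcases List.mem_append.1 hz with h | h
      exacts [hH z h, (hst₁ z h).inGrid]
    have hpB : p.1 ≤ B₁.1 := (hτ₁ _ (hLτ₁ _ hL₁.last_mem)).1
    -- the second copy
    have hs₂ : ∀ z : Node, B₁.1 + (2 * T + 2) ≤ z.1 →
        z.1 ≤ B₁.1 + (2 * T + 2) + stripWidth T j →
        |lineHeight m z - lineHeight m p| ≤ j + 1 + 1 → Safe N T (H ++ τ₁) z := by
      intro z h1 h2 h3
      have := hs z (by omega) (by omega) h3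
      refine ⟨this.1, fun w hw => ?_⟩
      rcases List.mem_append.1 hw with h | h
      · exact this.2 w h
      · have := (hτ₁ w h).2.1
        unfold l1; omega
    obtain ⟨p₂, hp₂, hpl₂, hpu₂⟩ : ∃ p₂ : Node, p₂.1 = B₁.1 + (2 * T + 2) ∧
        lineHeight m p - 1 ≤ lineHeight m p₂ ∧ lineHeight m p₂ ≤ lineHeight m p :=
        exists_node_of_lineHeight m (lineHeight m p) _
    obtain ⟨τ₂, L₂, b₂, B₂, x₂, y₂, hn₂, hL₂, hLτ₂, hτ₂, hb₂, hb₂', hB₂, hB₂', hBw₂, hx₂, hy₂,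
      hq₂⟩ := ih (H ++ τ₁) p₂ hH₁ fun z h1 h2 h3 => hs₂ z (by omega) (by omega) (by
        have := abs_le.1 h3
        exact abs_le.2 ⟨by linarith, by linarith⟩)
    have hst₂ : ∀ z ∈ τ₂, Safe N T (H ++ τ₁) z := by
      intro z hz
      obtain ⟨h1, h2, h3, h4⟩ := hτ₂ z hz
      exact hs₂ z (by omega) (by omega) (abs_le.2 ⟨by linarith, by linarith⟩)
    -- the vertical shift of the second copy
    obtain ⟨v, hvl, hvu, hvp⟩ : ∃ v : ℤ, b₁ - 1 ≤ b₂ + v ∧ b₂ + v ≤ b₁ + 1 ∧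
        ((if A.colorAt (H ++ τ₁) x₁ = 2 then (1 : ℤ) else 0) + x₁.1 + x₁.2 -
          ((if A.colorAt (H ++ τ₁ ++ τ₂) x₂ = 2 then (1 : ℤ) else 0) + x₂.1 + (x₂.2 + v))) % 2
            = 1 := by
      have f1 := Int.floor_le (b₁ - b₂)
      have f2 := Int.lt_floor_add_one (b₁ - b₂)
      generalize ⌊b₁ - b₂⌋ = v at f1 f2
      generalize (if A.colorAt (H ++ τ₁) x₁ = 2 then (1 : ℤ) else 0) = s
      generalize (if A.colorAt (H ++ τ₁ ++ τ₂) x₂ = 2 then (1 : ℤ) else 0) = t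
      -- Raising the copy by one more unit flips the parity. Both candidate shifts align the lower
      -- boundaries `b₁` and `b₂ + v` up to `1`.
      by_cases h : (s + x₁.1 + x₁.2 - (t + x₂.1 + (x₂.2 + v))) % 2 = 1
      · exact ⟨v, by linarith, by linarith, h⟩
      · exact ⟨v + 1, by push_cast; linarith, by push_cast; linarith, by omega⟩
    set t : Node := (0, v) with ht
    have hlt : ∀ z, lineHeight m (z + t) = lineHeight m z + v := by
      intro z; simp only [lineHeight, ht, Prod.fst_add, Prod.snd_add]; push_cast; ring
    have hst₂' : ∀ z ∈ τ₂, Safe N T (H ++ τ₁) (z + t) := by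
      intro z hz
      obtain ⟨h1, h2, h3, h4⟩ := hτ₂ z hz
      refine hs₂ _ (by simp [ht]; omega) (by simp [ht]; omega) ?_
      rw [hlt]
      exact abs_le.2 ⟨by linarith, by linarith⟩
    -- The two boundaries differ by at most `1`, so a strip one unit higher than each of the two
    -- holds both copies.
    set b := min b₁ (b₂ + v) with hb
    have hbb₁ : b ≤ b₁ := min_le_left _ _
    have hbb₂ : b ≤ b₂ + v := min_le_right _ _
    have hb1 : b₁ - 1 ≤ b := le_min (by linarith) hvl
    have hb2 : b₂ + v - 1 ≤ b := le_min (by linarith) (by linarith)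
    have hj : (0 : ℝ) ≤ j := Nat.cast_nonneg j
    -- the path in between
    have e1 : lineHeight m (B₁.1 + 1, B₁.2) = lineHeight m B₁ - m := by
      simp only [lineHeight]; push_cast; ring
    have e2 : lineHeight m (B₁.1 + 1 + (2 * T : ℕ), p₂.2 + v) = lineHeight m p₂ + v + m := by
      simp only [lineHeight, hp₂]; push_cast; ring
    obtain ⟨γ, hγ, hγb⟩ := exists_path_in_strip (c := b + 1) (lo := b - 1) (hi := b + j + 2) hm
      (by linarith) (by linarith) (2 * T) (B₁.1 + 1) B₁.2 (p₂.2 + v)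
      (by rw [e1]; linarith) (by rw [e1]; linarith) (by rw [e2]; linarith) (by rw [e2]; linarith)
    have hL₂' := hL₂.translate t
    have hγx : ∀ z ∈ γ, B₁.1 < z.1 ∧ z.1 < p₂.1 := by
      intro z hz
      obtain ⟨h1, h2, -⟩ := hγb z hz
      push_cast at h2
      omega
    have hx₂' : ∀ z ∈ τ₂.map (· + t), p₂.1 ≤ z.1 ∧ z.1 ≤ B₂.1 ∧
        b₂ + v - 1 ≤ lineHeight m z ∧ lineHeight m z ≤ b₂ + v + j + 1 := by
      intro z hz
      obtain ⟨w, hw, rfl⟩ := List.mem_map.1 hz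
      obtain ⟨h1, h2, h3, h4⟩ := hτ₂ w hw
      rw [hlt]
      exact ⟨by simpa [ht] using h1, by simpa [ht] using h2, by linarith, by linarith⟩
    have hLτ₂' : ∀ z ∈ L₂.map (· + t), z ∈ τ₂.map (· + t) := by
      intro z hz
      obtain ⟨w, hw, rfl⟩ := List.mem_map.1 hz
      exact List.mem_map_of_mem (hLτ₂ w hw)
    have hL : PathFromTo (L₁ ++ (γ ++ L₂.map (· + t))) p (B₂ + t) := by
      refine hL₁.append (hγ.append hL₂' ?_ ?_) ?_ ?_
      · simp [l1, ht, hp₂]; omega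
      · intro z hz hz'
        have := hγx z hz
        have := hx₂' z (hLτ₂' z hz')
        omega
      · simp [l1]
      · intro z hz hz'
        have := hτ₁ z (hLτ₁ z hz)
        rcases List.mem_append.1 hz' with h | h
        · have := hγx z h
          omega
        · have := hx₂' z (hLτ₂' z h)
          omega
    -- The connecting path `γ` is revealed last, so it cannot influence the colors of the two
    -- copies. Those of the shifted copy are the ones already used to choose `v`.
    have hcol₁ : ∀ z ∈ τ₁, A.colorAt (H ++ (τ₁ ++ (τ₂.map (· + t) ++ γ))) z =
        A.colorAt (H ++ τ₁) z := by
      intro z hz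
      rw [← List.append_assoc]
      exact colorAt_append_left A _ (List.mem_append_right _ hz)
    have hcol₂ : ∀ z ∈ τ₂, A.colorAt (H ++ (τ₁ ++ (τ₂.map (· + t) ++ γ))) (z + t) =
        A.colorAt (H ++ τ₁ ++ τ₂) z := by
      intro z hz
      rw [← List.append_assoc, ← List.append_assoc,
        colorAt_append_left A _ (List.mem_append_right _ (List.mem_map_of_mem hz))]
      exact colorAt_translate A t hH₁ hst₂ hst₂' hz
    set c := A.colorAt (H ++ (τ₁ ++ (τ₂.map (· + t) ++ γ))) with hc
    have hLτ : ∀ z ∈ L₁ ++ (γ ++ L₂.map (· + t)), z ∈ τ₁ ++ (τ₂.map (· + t) ++ γ) := by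
      intro z hz
      rcases List.mem_append.1 hz with h | h
      · exact List.mem_append_left _ (hLτ₁ z h)
      rcases List.mem_append.1 h with h | h
      · exact List.mem_append_right _ (List.mem_append_right _ h)
      · exact List.mem_append_right _ (List.mem_append_left _ (hLτ₂' z h))
    -- The nodes `x` and `y` must not depend on the height function: they are chosen with one height
    -- `h₀`, and `IsHeight.sub_eq_sub` transfers the drop to every other.
    obtain ⟨x, y, hx, hy, hxy⟩ : ∃ x y, x ∈ L₁ ++ (γ ++ L₂.map (· + t)) ∧
        y ∈ L₁ ++ (γ ++ L₂.map (· + t)) ∧ (ProperOn c (τ₁ ++ (τ₂.map (· + t) ++ γ)) →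
          ∀ h, IsHeight c h (L₁ ++ (γ ++ L₂.map (· + t))) → (j : ℤ) + 1 ≤ h x - h y) := by
      have mem₁ : ∀ {z}, z ∈ L₁ → z ∈ L₁ ++ (γ ++ L₂.map (· + t)) :=
        fun h => List.mem_append_left _ h
      have mem₂ : ∀ {z}, z ∈ L₂ → z + t ∈ L₁ ++ (γ ++ L₂.map (· + t)) :=
        fun h => List.mem_append_right _ (List.mem_append_right _ (List.mem_map_of_mem h))
      by_cases hprop : ProperOn c (τ₁ ++ (τ₂.map (· + t) ++ γ))
      swap
      · exact ⟨x₁, x₁, mem₁ hx₁, mem₁ hx₁, fun h => absurd h hprop⟩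
      obtain ⟨h₀, hh₀⟩ := exists_isHeight c hL.2.1
      have d1 : (j : ℤ) ≤ h₀ x₁ - h₀ y₁ := by
        refine hp₁ ?_ h₀ ?_
        · intro z hz w hw hzw
          rw [← hcol₁ z hz, ← hcol₁ w hw]
          exact hprop z (List.mem_append_left _ hz) w (List.mem_append_left _ hw) hzw
        · exact IsHeight.congr (List.IsChain.left_of_append hh₀)
            (fun z hz => hcol₁ z (hLτ₁ z hz)) fun _ _ => rfl
      have d2 : (j : ℤ) ≤ h₀ (x₂ + t) - h₀ (y₂ + t) := by
        refine hq₂ ?_ (fun z => h₀ (z + t)) ?_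
        · intro z hz w hw hzw
          rw [← hcol₂ z hz, ← hcol₂ w hw]
          refine hprop _ ?_ _ ?_ (by rw [l1_add, hzw]) <;>
            exact List.mem_append_right _ (List.mem_append_left _ (List.mem_map_of_mem ‹_›))
        · have h1 : IsHeight c h₀ (L₂.map (· + t)) :=
            List.IsChain.right_of_append (List.IsChain.right_of_append hh₀)
          unfold IsHeight at h1
          rw [List.isChain_map] at h1
          refine isChain_imp_of_mem h1 fun z hz w hw hzw => ?_
          rw [← hzw]
          unfold edgePotential
          rw [hcol₂ z (hLτ₂ z hz), hcol₂ w (hLτ₂ w hw)]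
      have par := hh₀.parity hL.1 (isChain_imp_of_mem hL.1 fun z hz w hw hzw =>
        hprop z (hLτ z hz) w (hLτ w hw) hzw) (mem₁ hx₁) (mem₂ hx₂)
      rw [hcol₁ _ (hLτ₁ _ hx₁), hcol₂ _ (hLτ₂ _ hx₂)] at par
      have ex1 : (x₂ + t).1 = x₂.1 := by simp [ht]
      have ex2 : (x₂ + t).2 = x₂.2 + v := by simp [ht]
      rw [ex1, ex2] at par
      generalize (if A.colorAt (H ++ τ₁) x₁ = 2 then (1 : ℤ) else 0) = s at par hvp
      generalize (if A.colorAt (H ++ τ₁ ++ τ₂) x₂ = 2 then (1 : ℤ) else 0) = s' at par hvp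
      -- By `par` and `hvp` the two heights have different parity, so the second case is strict as
      -- well, and the strict inequality supplies the additional unit of drop.
      rcases lt_or_ge (h₀ x₁) (h₀ (x₂ + t)) with hlt | hge
      · refine ⟨x₂ + t, y₁, mem₂ hx₂, mem₁ hy₁, fun _ h hh => ?_⟩
        rw [hh.sub_eq_sub hh₀ (mem₂ hx₂) (mem₁ hy₁)]
        omega
      · refine ⟨x₁, y₂ + t, mem₁ hx₁, mem₂ hy₂, fun _ h hh => ?_⟩
        rw [hh.sub_eq_sub hh₀ (mem₁ hx₁) (mem₂ hy₂)]
        omega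
    have hB1 : (B₂ + t).1 = B₂.1 := by simp [ht]
    have hpB₂ : p₂.1 ≤ B₂.1 := (hτ₂ _ (hLτ₂ _ hL₂.last_mem)).1
    refine ⟨τ₁ ++ (τ₂.map (· + t) ++ γ), L₁ ++ (γ ++ L₂.map (· + t)), b, B₂ + t, x, y, ?_, hL,
      hLτ, ?_, by linarith, by linarith, by rw [hlt]; linarith, by rw [hlt]; linarith,
      by omega, hx, hy, hxy⟩
    · refine List.nodup_append'.2 ⟨hn₁, List.nodup_append'.2
        ⟨hn₂.map (add_left_injective t), hγ.2.1, ?_⟩, ?_⟩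
      · intro z hz hz'
        have := hγx z hz'
        have := hx₂' z hz
        omega
      · intro z hz hz'
        have := hτ₁ z hz
        rcases List.mem_append.1 hz' with h | h
        · have := hx₂' z h
          omega
        · have := hγx z h
          omega
    · intro z hz
      rcases List.mem_append.1 hz with h | h
      · obtain ⟨h1, h2, h3, h4⟩ := hτ₁ z h
        exact ⟨h1, by omega, by linarith, by linarith⟩
      rcases List.mem_append.1 h with h | h
      · obtain ⟨h1, h2, h3, h4⟩ := hx₂' z h
        exact ⟨by omega, by omega, by linarith, by linarith⟩
      · have := hγx z h
        obtain ⟨-, -, h3, h4⟩ := hγb z h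
        exact ⟨by omega, by omega, by linarith, by linarith⟩

/-! ### Heights on the whole grid -/

/-- With three colors, some two opposite corners of a properly colored square agree. If they are `y`
and `z` the two sides coincide; if they are `x` and `w` both vanish. -/
lemma edgePotential_square {c : Node → Fin 3} {x y z w : Node} (h1 : c x ≠ c y) (h2 : c y ≠ c w)
    (h3 : c x ≠ c z) (h4 : c z ≠ c w) :
    edgePotential c x y + edgePotential c y w = edgePotential c x z + edgePotential c z w := by
  unfold edgePotential
  generalize c x = a at *
  generalize c y = b at *
  generalize c z = d at *
  generalize c w = e at *
  revert a b d e; decide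

/-- The potential of walks in a properly colored grid comes from a height function. -/
lemma exists_grid_height {N : ℕ} (c : (grid N).Coloring (Fin 3)) :
    ∃ h : Node → ℤ, ∀ z w, (grid N).Adj z w → edgePotential c z w = h z - h w := by
  set P : ℕ → ℕ → Node := fun a b => ((a : ℤ) + 1, (b : ℤ) + 1) with hP
  have hPin : ∀ a b, a < N → b < N → InGrid N (P a b) := by
    intro a b ha hb
    simp only [InGrid, hP]; omega
  have hne : ∀ a b a' b', a < N → b < N → a' < N → b' < N → l1 (P a b) (P a' b') = 1 →
      c (P a b) ≠ c (P a' b') := fun a b a' b' h1 h2 h3 h4 h5 =>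
    c.valid (grid_adj_iff.2 ⟨hPin _ _ h1 h2, hPin _ _ h3 h4, h5⟩)
  set S : ℕ → ℤ := fun a => ∑ i ∈ Finset.range a, edgePotential c (P i 0) (P (i + 1) 0) with hS
  set V : ℕ → ℕ → ℤ := fun a b => ∑ j ∈ Finset.range b, edgePotential c (P a j) (P a (j + 1))
    with hV
  -- The candidate height sums potentials along the bottom row and then up a column. Vertical edges
  -- fit by construction; horizontal ones follow by stacking squares upward.
  have hor : ∀ a b, a + 1 < N → b < N →
      edgePotential c (P a b) (P (a + 1) b) = S (a + 1) + V (a + 1) b - (S a + V a b) := by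
    intro a b ha hb
    induction b with
    | zero => simp [hS, hV, Finset.sum_range_succ]
    | succ b ih =>
      have e1 : V a (b + 1) = V a b + edgePotential c (P a b) (P a (b + 1)) :=
        Finset.sum_range_succ _ _
      have e2 : V (a + 1) (b + 1) =
          V (a + 1) b + edgePotential c (P (a + 1) b) (P (a + 1) (b + 1)) :=
        Finset.sum_range_succ _ _
      have sq := edgePotential_square (c := c)
        (hne a b (a + 1) b (by omega) (by omega) (by omega) (by omega) (by simp [l1, hP]))
        (hne (a + 1) b (a + 1) (b + 1) (by omega) (by omega) (by omega) (by omega)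
          (by simp [l1, hP]))
        (hne a b a (b + 1) (by omega) (by omega) (by omega) (by omega) (by simp [l1, hP]))
        (hne a (b + 1) (a + 1) (b + 1) (by omega) (by omega) (by omega) (by omega)
          (by simp [l1, hP]))
      have := ih (by omega)
      rw [e1, e2]
      linarith
  have coord : ∀ z, InGrid N z → ∃ a b, a < N ∧ b < N ∧ z = P a b := by
    intro z hz
    unfold InGrid at hz
    exact ⟨(z.1 - 1).toNat, (z.2 - 1).toNat, by omega, by omega,
      Prod.ext (by simp only [hP]; omega) (by simp only [hP]; omega)⟩
  refine ⟨fun z => -(S (z.1 - 1).toNat + V (z.1 - 1).toNat (z.2 - 1).toNat), ?_⟩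
  have hval : ∀ a b, -(S ((P a b).1 - 1).toNat + V ((P a b).1 - 1).toNat ((P a b).2 - 1).toNat) =
      -(S a + V a b) := by intro a b; simp [hP]
  have hE : ∀ z w, East N z w → edgePotential c z w =
      -(S (z.1 - 1).toNat + V (z.1 - 1).toNat (z.2 - 1).toNat) -
      -(S (w.1 - 1).toNat + V (w.1 - 1).toNat (w.2 - 1).toNat) := by
    rintro z w ⟨hz, hw, h1, h2⟩
    obtain ⟨a, b, ha, hb, rfl⟩ := coord z hz
    obtain ⟨a', b', ha', hb', rfl⟩ := coord w hw
    simp only [hval]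
    simp only [hP] at h1 h2
    obtain rfl : a' = a + 1 := by omega
    obtain rfl : b' = b := by omega
    rw [hor a b' ha' hb]; ring
  have hN : ∀ z w, North N z w → edgePotential c z w =
      -(S (z.1 - 1).toNat + V (z.1 - 1).toNat (z.2 - 1).toNat) -
      -(S (w.1 - 1).toNat + V (w.1 - 1).toNat (w.2 - 1).toNat) := by
    rintro z w ⟨hz, hw, h1, h2⟩
    obtain ⟨a, b, ha, hb, rfl⟩ := coord z hz
    obtain ⟨a', b', ha', hb', rfl⟩ := coord w hw
    simp only [hval]
    simp only [hP] at h1 h2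
    obtain rfl : a' = a := by omega
    obtain rfl : b' = b + 1 := by omega
    have e1 : V a' (b + 1) = V a' b + edgePotential c (P a' b) (P a' (b + 1)) :=
      Finset.sum_range_succ _ _
    rw [e1]; ring
  rintro z w (h | h | h | h)
  · exact hE z w h
  · rw [edgePotential_symm, hE w z h]; ring
  · exact hN z w h
  · rw [edgePotential_symm, hN w z h]; ring

/-! ### L-paths -/

/-- A simple path in `ℤ` is monotone. -/
lemma path_int_monotone {l : List ℤ} (hl : l.IsChain fun a b => (a - b).natAbs = 1)
    (hn : l.Nodup) {a b : ℤ} (ha : l.head? = some a) (hb : l.getLast? = some b) :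
    (b - a).natAbs + 1 = l.length ∧ ∀ z ∈ l, min a b ≤ z ∧ z ≤ max a b := by
  induction l generalizing a with
  | nil => simp at ha
  | cons x l ih =>
    obtain rfl : x = a := by simpa using ha
    cases l with
    | nil =>
      obtain rfl : x = b := by simpa using hb
      simp
    | cons y l =>
      rw [List.isChain_cons_cons] at hl
      have hb' : (y :: l).getLast? = some b := by simpa using hb
      obtain ⟨h1, h2⟩ := ih hl.2 hn.of_cons rfl hb'
      have hx : x ∉ y :: l := (List.nodup_cons.1 hn).1
      have hxy := hl.1
      have hout : x < min y b ∨ max y b < x := by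
        cases l with
        | nil =>
          obtain rfl : y = b := by simpa using hb'
          simp; omega
        | cons w l =>
          have hw := (List.isChain_cons_cons.1 hl.2).1
          have hxw : x ≠ w := fun e => hx (by simp [e])
          have := h2 w (by simp)
          omega
      refine ⟨by simp only [List.length_cons] at *; omega, fun z hz => ?_⟩
      rcases List.mem_cons.1 hz with rfl | hz
      · omega
      · have := h2 z hz
        omega

/-- The corner `W[r]` belongs to both parts, and each part projects to a simple, hence monotone,
path in `ℤ`. -/
lemma IsLPath.spec {N : ℕ} {W : List Node} {r : ℕ} {u v : Node} (hW : IsLPath N W r)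
    (hu : W.head? = some u) (hv : W.getLast? = some v) :
    (v.1 - u.1).natAbs = r ∧ (v.2 - u.2).natAbs = W.length - 1 - r ∧
      ∀ z ∈ W, (z.2 = u.2 ∧ min u.1 v.1 ≤ z.1 ∧ z.1 ≤ max u.1 v.1) ∨
        (z.1 = v.1 ∧ min u.2 v.2 ≤ z.2 ∧ z.2 ≤ max u.2 v.2) := by
  obtain ⟨⟨hc, hn⟩, hr, ⟨y, hy⟩, ⟨x, hx⟩⟩ := hW
  have hadj : W.IsChain fun a b => l1 a b = 1 := hc.imp fun a b hab => (grid_adj_iff.1 hab).2.2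
  have htl : (W.take (r + 1)).length = r + 1 := by rw [List.length_take]; omega
  set κ := W[r]'(by omega) with hκ
  have hκt : (W.take (r + 1)).getLast? = some κ := by
    rw [List.getLast?_eq_getElem?, htl]
    simp [hκ]
  have hκd : (W.drop r).head? = some κ := by
    rw [List.head?_drop]
    simp [hκ]
  have hut : (W.take (r + 1)).head? = some u := by rw [List.head?_take]; simp [hu]
  have hvd : (W.drop r).getLast? = some v := by
    rw [List.getLast?_drop, if_neg (by omega), hv]
  have ey : κ.2 = u.2 := by
    rw [hy κ (List.mem_of_getLast? hκt), hy u (List.mem_of_head? hut)]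
  have ex : κ.1 = v.1 := by
    rw [hx κ (List.mem_of_head? hκd), hx v (List.mem_of_getLast? hvd)]
  have htc := hadj.take (r + 1)
  have hdc := hadj.drop r
  obtain ⟨a1, a2⟩ := path_int_monotone (l := (W.take (r + 1)).map Prod.fst)
    (by
      rw [List.isChain_map]
      refine isChain_imp_of_mem htc fun a ha b hb hab => ?_
      have := hy a ha
      have := hy b hb
      unfold l1 at hab; omega)
    (List.Nodup.map_on (fun a ha b hb hab => Prod.ext hab (by rw [hy a ha, hy b hb]))
      (hn.sublist (List.take_sublist _ _)))
    (a := u.1) (b := κ.1) (by rw [List.head?_map, hut]; rfl)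
    (by rw [List.getLast?_map, hκt]; rfl)
  obtain ⟨b1, b2⟩ := path_int_monotone (l := (W.drop r).map Prod.snd)
    (by
      rw [List.isChain_map]
      refine isChain_imp_of_mem hdc fun a ha b hb hab => ?_
      have := hx a ha
      have := hx b hb
      unfold l1 at hab; omega)
    (List.Nodup.map_on (fun a ha b hb hab => Prod.ext (by rw [hx a ha, hx b hb]) hab)
      (hn.sublist (List.drop_sublist _ _)))
    (a := κ.2) (b := v.2) (by rw [List.head?_map, hκd]; rfl)
    (by rw [List.getLast?_map, hvd]; rfl)
  rw [List.length_map, htl, ex] at a1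
  rw [List.length_map, List.length_drop, ey] at b1
  refine ⟨by omega, by omega, fun z hz => ?_⟩
  have : z ∈ W.take (r + 1) ∨ z ∈ W.drop r := by
    have : z ∈ W.take r ++ W.drop r := by rwa [List.take_append_drop]
    rcases List.mem_append.1 this with h | h
    · exact Or.inl ((List.take_sublist_take_left (by omega)).subset h)
    · exact Or.inr h
  rcases this with h | h
  · left
    rw [← ex]
    exact ⟨by rw [hy z h, hy u (List.mem_of_head? hut)], a2 _ (List.mem_map_of_mem h)⟩
  · right
    rw [← ey]
    exact ⟨by rw [hx z h, hx v (List.mem_of_getLast? hvd)], b2 _ (List.mem_map_of_mem h)⟩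

/-! ### Windows of small potential -/

/-- Shifting a window by one changes its increment by at most `4`, too little to jump from at least
`3` to at most `-3`. If no window worked, every increment would be at least `3`, and `g` could not
return to `g 0`. -/
lemma exists_window_of_nonneg {g : ℕ → ℤ} {r k : ℕ} (hg : ∀ i < r, |g (i + 1) - g i| ≤ 2)
    (h0 : g 0 = g r) (hk : k ^ 2 ≤ r) (hstart : -2 ≤ g k - g 0) :
    ∃ s, s + k ≤ r ∧ |g (s + k) - g s| ≤ 2 := by
  by_contra! H
  have hkr : k ≤ r := by nlinarith
  have pos : ∀ s, s + k ≤ r → 3 ≤ g (s + k) - g s := by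
    intro s
    induction s with
    | zero =>
      intro hs
      have := H 0 hs
      rw [zero_add] at *
      rcases lt_abs.1 this with h | h <;> omega
    | succ s ih =>
      intro hs
      have h1 := ih (by omega)
      have h2 := abs_le.1 (hg s (by omega))
      have h3 := abs_le.1 (hg (s + k) (by omega))
      have h4 := H (s + 1) hs
      rw [show s + 1 + k = s + k + 1 by ring] at *
      rcases lt_abs.1 h4 with h | h <;> omega
  rcases Nat.eq_zero_or_pos k with rfl | hk0
  · have := pos 0 (by omega)
    simp at this
  have far : ∀ q, q * k ≤ r → 3 * (q : ℤ) ≤ g (q * k) - g 0 := by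
    intro q
    induction q with
    | zero => intro; simp
    | succ q ih =>
      intro hq
      rw [Nat.succ_mul] at *
      have h1 := ih (by omega)
      have h2 := pos (q * k) hq
      push_cast
      omega
  have drift : ∀ i j, i + j ≤ r → g (i + j) - g i ≥ -(2 * (j : ℤ)) := by
    intro i j
    induction j with
    | zero => intro; simp
    | succ j ih =>
      intro hj
      have h1 := ih (by omega)
      have h2 := abs_le.1 (hg (i + j) (by omega))
      rw [← add_assoc]
      push_cast
      omega
  -- There are `r / k ≥ k` disjoint windows, gaining `3` each, and `r % k < k` leftover steps,
  -- losing at most `2` each. The total is positive.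
  have e := Nat.div_add_mod r k
  have hlt := Nat.mod_lt r hk0
  have hq : k ≤ r / k := (Nat.le_div_iff_mul_le hk0).2 (by rw [← sq]; exact hk)
  have f := far (r / k) (Nat.div_mul_le_self r k)
  have d := drift (r / k * k) (r % k) (by rw [mul_comm]; exact e.le)
  rw [show r / k * k + r % k = r by rw [mul_comm]; exact e] at d
  omega

/-- If `g` has increments at most `2` and returns to its initial value, then its increment over some
window of length `k` is at most `2`. -/
lemma exists_window {g : ℕ → ℤ} {r k : ℕ} (hg : ∀ i < r, |g (i + 1) - g i| ≤ 2)
    (h0 : g 0 = g r) (hk : k ^ 2 ≤ r) : ∃ s, s + k ≤ r ∧ |g (s + k) - g s| ≤ 2 := by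
  rcases le_total 0 (g k - g 0) with h | h
  · exact exists_window_of_nonneg hg h0 hk (by omega)
  · obtain ⟨s, h1, h2⟩ := exists_window_of_nonneg (g := fun i => - g i) (r := r) (k := k)
      (fun i hi => by
        rw [← abs_neg]
        convert hg i hi using 2
        ring) (by simp [h0]) hk (by omega)
    refine ⟨s, h1, ?_⟩
    rw [← abs_neg]
    convert h2 using 2
    ring

/-! ### Sizes -/

lemma stripWidth_eq (T j : ℕ) : stripWidth T j = (2 ^ j - 1) * (2 * T + 2) := by
  induction j with
  | zero => simp [stripWidth]
  | succ j ih =>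
    have : 1 ≤ 2 ^ j := Nat.one_le_two_pow
    obtain ⟨a, ha⟩ := Nat.exists_eq_add_of_le this
    rw [stripWidth, ih, pow_succ, ha]
    have e1 : 1 + a - 1 = a := by omega
    have e2 : (1 + a) * 2 - 1 = 2 * a + 1 := by omega
    rw [e1, e2]; ring

lemma stripWidth_le (t : ℕ) : stripWidth t (10 * t) ≤ 2 ^ (10 * t) * (4 * t) := by
  rcases Nat.eq_zero_or_pos t with rfl | ht
  · simp [stripWidth]
  · rw [stripWidth_eq]
    exact Nat.mul_le_mul (Nat.sub_le _ _) (by omega)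

lemma stripWidth_sq_le (t : ℕ) : stripWidth t (10 * t) ^ 2 ≤ 2 ^ (100 * t) := by
  have h1 : 4 * t ≤ 2 ^ (2 * t) * 2 ^ (2 * t) := by
    have h2 : t ≤ 2 ^ t := Nat.lt_two_pow_self.le
    rcases Nat.eq_zero_or_pos t with rfl | ht
    · simp
    · have h3 : (2 : ℕ) ^ 2 ≤ 2 ^ (2 * t) := Nat.pow_le_pow_right (by norm_num) (by omega)
      have h4 : (2 : ℕ) ^ t ≤ 2 ^ (2 * t) := Nat.pow_le_pow_right (by norm_num) (by omega)
      exact Nat.mul_le_mul (by simpa using h3) (h2.trans h4)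
  calc stripWidth t (10 * t) ^ 2 ≤ (2 ^ (10 * t) * (4 * t)) ^ 2 :=
        Nat.pow_le_pow_left (stripWidth_le t) 2
    _ ≤ (2 ^ (10 * t) * (2 ^ (2 * t) * 2 ^ (2 * t))) ^ 2 :=
        Nat.pow_le_pow_left (Nat.mul_le_mul_left _ h1) 2
    _ = 2 ^ (28 * t) := by rw [← pow_add, ← pow_add, ← pow_mul]; congr 1; ring
    _ ≤ 2 ^ (100 * t) := Nat.pow_le_pow_right (by norm_num) (by omega)

/-- Once `t ≤ log (N ^ 2) / 44`, one has `2 ^ (11 * t) ≤ √N`. The left side is at most `44 * 2 ^ (10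
* t) * (t + 1) ≤ 44 √N`, which is below `δ * N` for `N ≥ (44 / δ) ^ 2`. -/
lemma eventually_stripWidth_le {T : ℕ → ℕ}
    (hT : (fun n : ℕ => (T n : ℝ)) =o[atTop] (fun n : ℕ => Real.log (n : ℝ))) {δ : ℝ}
    (hδ : 0 < δ) : ∀ᶠ N : ℕ in atTop,
      (stripWidth (T (N ^ 2)) (10 * T (N ^ 2)) : ℝ) + 40 * (T (N ^ 2) + 1) ≤ δ * N := by
  have h1 := hT.bound (show (0 : ℝ) < 1 / 44 by norm_num)
  have h2 : Tendsto (fun N : ℕ => N ^ 2) atTop atTop := tendsto_pow_atTop (by norm_num)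
  have h3 := h2.eventually h1
  have h4 : ∀ᶠ N : ℕ in atTop, (44 / δ) ^ 2 ≤ (N : ℝ) :=
    tendsto_natCast_atTop_atTop.eventually_ge_atTop _
  filter_upwards [h3, h4, eventually_ge_atTop 1] with N h3 h4 h5
  set t := T (N ^ 2)
  have hN : (1 : ℝ) ≤ N := by exact_mod_cast h5
  have hlog : 0 ≤ Real.log N := Real.log_nonneg hN
  have ht : (t : ℝ) ≤ 1 / 22 * Real.log N := by
    have e : Real.log ((N ^ 2 : ℕ) : ℝ) = 2 * Real.log N := by push_cast; rw [Real.log_pow]; simp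
    rw [e, Real.norm_of_nonneg (Nat.cast_nonneg _), Real.norm_of_nonneg (by linarith)] at h3
    linarith
  have hpow : (2 : ℝ) ^ (11 * t) ≤ Real.sqrt N := by
    have a1 : (2 : ℝ) ≤ Real.exp 1 := by have := Real.add_one_le_exp (1 : ℝ); linarith
    calc (2 : ℝ) ^ (11 * t) ≤ (Real.exp 1) ^ (11 * t) := pow_le_pow_left₀ (by norm_num) a1 _
      _ = Real.exp (11 * t) := by rw [← Real.exp_nat_mul]; push_cast; ring_nf
      _ ≤ Real.exp (Real.log N / 2) := Real.exp_le_exp.2 (by linarith)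
      _ = Real.sqrt N := by
        rw [Real.exp_half, Real.exp_log (by linarith)]
  have ht2 : (t : ℝ) + 1 ≤ 2 ^ t := by exact_mod_cast Nat.lt_two_pow_self
  have hs : (stripWidth t (10 * t) : ℝ) ≤ 2 ^ (10 * t) * (4 * t) := by
    exact_mod_cast stripWidth_le t
  have hp1 : (1 : ℝ) ≤ 2 ^ (10 * t) := one_le_pow₀ (by norm_num)
  have hsq : 44 * Real.sqrt N ≤ δ * N := by
    have b1 : 44 / δ ≤ Real.sqrt N := Real.le_sqrt_of_sq_le h4
    have b2 : 44 ≤ Real.sqrt N * δ := (div_le_iff₀ hδ).1 b1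
    have b3 := Real.mul_self_sqrt (show (0 : ℝ) ≤ N by linarith)
    calc 44 * Real.sqrt N ≤ Real.sqrt N * δ * Real.sqrt N :=
          mul_le_mul_of_nonneg_right b2 (Real.sqrt_nonneg _)
      _ = δ * (Real.sqrt N * Real.sqrt N) := by ring
      _ = δ * N := by rw [b3]
  have e : (2 : ℝ) ^ (11 * t) = 2 ^ (10 * t) * 2 ^ t := by rw [← pow_add]; congr 1; ring
  have h6 : (2 : ℝ) ^ (10 * t) * (t + 1) ≤ 2 ^ (10 * t) * 2 ^ t :=
    mul_le_mul_of_nonneg_left ht2 (by linarith)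
  have h7 : (t : ℝ) + 1 ≤ 2 ^ (10 * t) * (t + 1) :=
    le_mul_of_one_le_left (by positivity) hp1
  nlinarith

/-! ### Diagonal paths -/

lemma diagNode_zero (u v : Node) : diagNode u v 0 = u := by
  simp [diagNode]

lemma lineHeight_diagNode (u v : Node) (i : ℕ) :
    lineHeight (lineSlope u v) u - 1 < lineHeight (lineSlope u v) (diagNode u v i) ∧
      lineHeight (lineSlope u v) (diagNode u v i) ≤ lineHeight (lineSlope u v) u := by
  have h1 := Int.floor_le (lineSlope u v * (i : ℝ))
  have h2 := Int.lt_floor_add_one (lineSlope u v * (i : ℝ))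
  simp only [lineHeight, diagNode]
  push_cast
  constructor <;> linarith

lemma diagNode_succ {u v : Node} (hm : |lineSlope u v| ≤ 1) (i : ℕ) :
    (diagNode u v (i + 1)).1 = (diagNode u v i).1 + 1 ∧
      ((diagNode u v (i + 1)).2 - (diagNode u v i).2).natAbs ≤ 1 := by
  have hm' := abs_le.1 hm
  have h1 := Int.floor_le (lineSlope u v * (i : ℝ))
  have h2 := Int.lt_floor_add_one (lineSlope u v * (i : ℝ))
  have h3 := Int.floor_le (lineSlope u v * ((i + 1 : ℕ) : ℝ))
  have h4 := Int.lt_floor_add_one (lineSlope u v * ((i + 1 : ℕ) : ℝ))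
  simp only [diagNode]
  generalize ⌊lineSlope u v * ((i + 1 : ℕ) : ℝ)⌋ = x at *
  generalize ⌊lineSlope u v * (i : ℝ)⌋ = y at *
  push_cast at *
  have h5 : (x : ℝ) < y + 2 := by linarith
  have h6 : (y : ℝ) < x + 2 := by linarith
  have h7 : x < y + 2 := by exact_mod_cast h5
  have h8 : y < x + 2 := by exact_mod_cast h6
  exact ⟨by ring, by omega⟩

lemma mem_diagWalk {u v z : Node} {s k : ℕ} : z ∈ diagWalk u v s k ↔
    (∃ i, s ≤ i ∧ i ≤ s + k ∧ z = diagNode u v i) ∨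
      ∃ i, s ≤ i ∧ i < s + k ∧ (diagNode u v i).2 ≠ (diagNode u v (i + 1)).2 ∧
        z = ((diagNode u v (i + 1)).1, (diagNode u v i).2) := by
  induction k with
  | zero =>
    simp only [diagWalk, List.mem_singleton, add_zero]
    constructor
    · rintro rfl; exact Or.inl ⟨s, le_rfl, le_rfl, rfl⟩
    · rintro (⟨i, h1, h2, rfl⟩ | ⟨i, h1, h2, -⟩)
      · rw [le_antisymm h1 h2]
      · omega
  | succ k ih =>
    rw [diagWalk, List.mem_append, List.mem_append, ih]
    constructor
    · rintro (((⟨i, h1, h2, h3⟩ | ⟨i, h1, h2, h3⟩) | h) | h)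
      · exact Or.inl ⟨i, h1, by omega, h3⟩
      · exact Or.inr ⟨i, h1, by omega, h3⟩
      · split_ifs at h with he
        · simp at h
        · exact Or.inr ⟨s + k, by omega, by omega, he, by simpa using h⟩
      · exact Or.inl ⟨s + k + 1, by omega, by omega, by simpa using h⟩
    · rintro (⟨i, h1, h2, h3⟩ | ⟨i, h1, h2, h3, h4⟩)
      · rcases Nat.lt_or_ge i (s + k + 1) with h | h
        · exact Or.inl (Or.inl (Or.inl ⟨i, h1, by omega, h3⟩))
        · obtain rfl : i = s + k + 1 := by omega
          exact Or.inr (by simp [h3])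
      · rcases Nat.lt_or_ge i (s + k) with h | h
        · exact Or.inl (Or.inl (Or.inr ⟨i, h1, h, h3, h4⟩))
        · obtain rfl : i = s + k := by omega
          exact Or.inl (Or.inr (by rw [if_neg h3, h4]; simp))

lemma diagWalk_spec {u v : Node} (hm : |lineSlope u v| ≤ 1) (s k : ℕ) :
    (diagWalk u v s k).IsChain (fun a b => l1 a b = 1) ∧
      (diagWalk u v s k).head? = some (diagNode u v s) ∧
      (diagWalk u v s k).getLast? = some (diagNode u v (s + k)) := by
  induction k with
  | zero => exact ⟨by simp [diagWalk], rfl, rfl⟩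
  | succ k ih =>
    obtain ⟨h1, h2, h3⟩ := ih
    obtain ⟨e1, e2⟩ := diagNode_succ hm (s + k)
    refine ⟨?_, ?_, ?_⟩
    · rw [diagWalk]
      split_ifs with h
      · rw [List.append_nil]
        refine List.isChain_append.2 ⟨h1, by simp, ?_⟩
        intro x hx y hy
        rw [h3, Option.mem_some_iff] at hx
        obtain rfl : diagNode u v (s + k + 1) = y := by simpa using hy
        rw [← hx]
        unfold l1; omega
      · rw [List.append_assoc]
        refine List.isChain_append.2 ⟨h1, ?_, ?_⟩
        · simp only [List.cons_append, List.nil_append, List.isChain_cons_cons,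
            List.IsChain.singleton, and_true]
          unfold l1
          dsimp only
          omega
        · intro x hx y hy
          rw [h3, Option.mem_some_iff] at hx
          obtain rfl : ((diagNode u v (s + k + 1)).1, (diagNode u v (s + k)).2) = y := by
            simpa using hy
          rw [← hx]
          unfold l1
          dsimp only
          omega
    · rw [diagWalk, List.append_assoc, List.head?_append, h2]; rfl
    · rw [diagWalk, List.getLast?_append]; rfl

lemma mem_diagNodes {u v z : Node} {s k : ℕ} :
    z ∈ diagNodes u v s k ↔ ∃ i ≤ k, z = diagNode u v (s + i) := by
  simp only [diagNodes, List.mem_map, List.mem_range, Nat.lt_succ_iff]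
  constructor
  · rintro ⟨i, h, rfl⟩; exact ⟨i, h, rfl⟩
  · rintro ⟨i, h, rfl⟩; exact ⟨i, h, rfl⟩

lemma abs_lineHeight_sub_le {m : ℝ} (hm : |m| ≤ 1) (z w : Node) :
    |lineHeight m z - lineHeight m w| ≤ l1 z w := by
  have e : lineHeight m z - lineHeight m w =
      ((z.2 - w.2 : ℤ) : ℝ) - m * ((z.1 - w.1 : ℤ) : ℝ) := by
    simp only [lineHeight]; push_cast; ring
  have e2 : (l1 z w : ℝ) = |((z.1 - w.1 : ℤ) : ℝ)| + |((z.2 - w.2 : ℤ) : ℝ)| := by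
    simp [l1, Nat.cast_natAbs]
  rw [e, e2]
  refine (abs_sub _ _).trans ?_
  rw [abs_mul, add_comm]
  have := mul_le_mul_of_nonneg_right hm (abs_nonneg ((z.1 - w.1 : ℤ) : ℝ))
  linarith

lemma mem_parallelogram_of_lineHeight {j : ℕ} {m β w : ℝ} {a : ℤ} {z : Node} (h1 : a ≤ z.1)
    (h2 : (z.1 : ℝ) ≤ a + w) (h3 : β ≤ lineHeight m z) (h4 : lineHeight m z ≤ β + (j + 1)) :
    z ∈ parallelogram j m a (β + m * a) w := by
  unfold lineHeight at *
  refine ⟨by exact_mod_cast h1, h2, ?_, ?_⟩ <;> linarith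

lemma potential_translate {c c' : Node → Fin 3} (t : Node) {L : List Node}
    (hc : ∀ z ∈ L, c' (z + t) = c z) : potential c' (L.map (· + t)) = potential c L := by
  induction L with
  | nil => rfl
  | cons x L ih =>
    cases L with
    | nil => rfl
    | cons y L =>
      have := ih fun z hz => hc z (List.mem_cons_of_mem _ hz)
      rw [List.map_cons, List.map_cons, potential, ← List.map_cons (f := (· + t)), this, potential]
      unfold edgePotential
      rw [hc x (by simp), hc y (by simp)]

/-! ### Placing the forced path next to the diagonal path -/

/-- Two safe strips occur because the gadget is run twice: `lo` bounds the trial position, where the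
strip found by the recursion may drift up or down, and `lo'` the final one, where its position is
known up to rounding by `1`. -/
theorem exists_reveal_near_diagonal {N t : ℕ} (A : OnlineLocalAlg N t) {u v : Node}
    (hm : |lineSlope u v| ≤ 1) (huv : u.1 < v.1) {σ : List Node} (hσn : σ.Nodup)
    (hσ : ∀ z ∈ σ, InGrid N z)
    (hD : ∀ s k, s + k ≤ hSpan u v → ∀ z ∈ diagWalk u v s k, z ∈ σ)
    (hwin : ∀ k ≤ stripWidth t (10 * t), ∃ s, s + k ≤ hSpan u v ∧
      |potential (A.colorAt σ) (diagWalk u v s k)| ≤ 2)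
    {lo lo' : ℝ} (hlo : -(12 * t + 6) ≤ lo') (hlo' : lo' ≤ 2 * t + 2)
    (hsafe : ∀ z : Node, u.1 - stripWidth t (10 * t) ≤ z.1 → z.1 ≤ v.1 + stripWidth t (10 * t) →
      lo ≤ lineHeight (lineSlope u v) z - lineHeight (lineSlope u v) u →
      lineHeight (lineSlope u v) z - lineHeight (lineSlope u v) u ≤ lo + (20 * t + 3) →
      Safe N t σ z)
    (hsafe' : ∀ z : Node, u.1 - stripWidth t (10 * t) ≤ z.1 → z.1 ≤ v.1 + stripWidth t (10 * t) →
      lo' ≤ lineHeight (lineSlope u v) z - lineHeight (lineSlope u v) u →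
      lineHeight (lineSlope u v) z - lineHeight (lineSlope u v) u ≤ lo' + (10 * t + 3) →
      Safe N t σ z) :
    ∃ τ : List Node, (σ ++ τ).Nodup ∧ (∀ z ∈ τ, InGrid N z) ∧
      (∀ z ∈ τ, ∀ w ∈ σ, 2 * t + 2 ≤ (grid N).dist z w) ∧
      (∃ a b w : ℝ, 0 ≤ w ∧ w ≤ 2 ^ (10 * t) * (4 * t) ∧
        ∀ z ∈ τ, z ∈ parallelogram (10 * t + 1) (lineSlope u v) a b w) ∧
      ((∃ z ∈ τ, ∃ w ∈ τ, (grid N).Adj z w ∧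
          A.colorAt (σ ++ τ) z = A.colorAt (σ ++ τ) w) ∨
        ∃ (R : List Node) (v₂ u₂ : Node), IsGridPath N R ∧ (∀ z ∈ R, z ∈ τ) ∧
          R.head? = some v₂ ∧ R.getLast? = some u₂ ∧
          potential (A.colorAt (σ ++ τ)) R = 10 * t ∧
          ∃ s k : ℕ, s + k ≤ hSpan u v ∧ (k : ℤ) = |u₂.1 - v₂.1| ∧
            |potential (A.colorAt (σ ++ τ)) (diagWalk u v s k)| ≤ 2 ∧
            2 * t + 2 ≤ pathDist N R (diagNodes u v s k) ∧
            pathDist N R (diagNodes u v s k) ≤ 12 * t + 7) := by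
  set m := lineSlope u v with hmdef
  set X := stripWidth t (10 * t) with hX
  have hXle : (X : ℝ) ≤ 2 ^ (10 * t) * (4 * t) := by exact_mod_cast stripWidth_le t
  have basic : ∀ τ : List Node, τ.Nodup → (∀ z ∈ τ, Safe N t σ z) →
      (σ ++ τ).Nodup ∧ (∀ z ∈ τ, InGrid N z) ∧
        ∀ z ∈ τ, ∀ w ∈ σ, 2 * t + 2 ≤ (grid N).dist z w := by
    intro τ hn hs
    refine ⟨List.nodup_append'.2 ⟨hσn, hn, fun z hz hz' => (hs z hz').notMem hz⟩,
      fun z hz => (hs z hz).inGrid, fun z hz w hw => ?_⟩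
    rw [dist_eq_l1 (hs z hz).inGrid (hσ w hw)]
    exact (hs z hz).2 w hw
  have par : ∀ (τ : List Node) (a : ℤ) (β : ℝ), (∀ z ∈ τ, a ≤ z.1 ∧ z.1 ≤ a + X ∧
      β ≤ lineHeight m z ∧ lineHeight m z ≤ β + 10 * t + 2) →
      ∃ a b w : ℝ, 0 ≤ w ∧ w ≤ 2 ^ (10 * t) * (4 * t) ∧
        ∀ z ∈ τ, z ∈ parallelogram (10 * t + 1) m a b w := by
    intro τ a β h
    refine ⟨a, β + m * a, X, Nat.cast_nonneg _, hXle, fun z hz => ?_⟩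
    obtain ⟨h1, h2, h3, h4⟩ := h z hz
    exact mem_parallelogram_of_lineHeight h1 (by exact_mod_cast h2) h3 (by push_cast; linarith)
  -- The start lies between `lo + 10t + 1` and `lo + 10t + 2` above the line, so a drift of `10t +
  -- 1` either way stays between `lo` and `lo + 20t + 3`.
  obtain ⟨p, hp1, hpl, hpu⟩ := exists_node_of_lineHeight m (lineHeight m u + lo + 10 * t + 2) u.1
  have hreg : ∀ z : Node, p.1 ≤ z.1 → z.1 ≤ p.1 + X →
      |lineHeight m z - lineHeight m p| ≤ (10 * t : ℕ) + 1 → Safe N t σ z := by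
    intro z h1 h2 h3
    have h3 := abs_le.1 h3
    push_cast at h3
    exact hsafe z (by omega) (by omega) (by linarith) (by linarith)
  obtain ⟨τ, L, b, B, x, y, hτn, hL, hLτ, hτ, hb, hb', hB, hB', hBX, hx, hy, hgood⟩ :=
    exists_strip_path A hm (10 * t) σ p hσ hreg
  push_cast at hτ hb hB' hgood
  have hτs : ∀ z ∈ τ, Safe N t σ z := by
    intro z hz
    obtain ⟨h1, h2, h3, h4⟩ := hτ z hz
    refine hreg z h1 (by omega) (abs_le.2 ⟨?_, ?_⟩) <;> push_cast <;> linarith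
  have hτb : ∀ z ∈ τ, p.1 ≤ z.1 ∧ z.1 ≤ p.1 + X ∧ b - 1 ≤ lineHeight m z ∧
      lineHeight m z ≤ b - 1 + 10 * t + 2 := by
    intro z hz
    obtain ⟨h1, h2, h3, h4⟩ := hτ z hz
    exact ⟨h1, by omega, h3, by linarith⟩
  by_cases hprop : ProperOn (A.colorAt (σ ++ τ)) τ
  swap
  -- A monochromatic edge in the trial run is already a failure, so the trial position itself is
  -- revealed.
  · obtain ⟨c1, c2, c3⟩ := basic τ hτn hτs
    refine ⟨τ, c1, c2, c3, par τ p.1 (b - 1) hτb, Or.inl ?_⟩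
    unfold ProperOn at hprop
    push Not at hprop
    obtain ⟨z, hz, w, hw, hzw, hcol⟩ := hprop
    exact ⟨z, hz, w, hw, grid_adj_iff.2 ⟨c2 z hz, c2 w hw, hzw⟩, hcol⟩
  obtain ⟨h, hh⟩ := exists_isHeight (A.colorAt (σ ++ τ)) hL.2.1
  obtain ⟨R, z, hRc, hRn, hRL, hRx, hRz, hRp⟩ := exists_path_potential_eq hh hL.2.1 hL.1 hx hy
    (J := 10 * t) (by positivity) (hgood hprop h hh)
  have hRτ : ∀ w ∈ R, w ∈ τ := fun w hw => hLτ w (hRL w hw)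
  have hxR := List.mem_of_head? hRx
  have hzR := List.mem_of_getLast? hRz
  obtain ⟨s, hsk, hpot⟩ := hwin (z.1 - x.1).natAbs (by
    have := hτb x (hRτ x hxR)
    have := hτb z (hRτ z hzR)
    omega)
  set k := (z.1 - x.1).natAbs with hk
  have hspan : (hSpan u v : ℤ) = v.1 - u.1 := by unfold hSpan; omega
  -- the western end of `R` is moved to the column of the western end of the window
  obtain ⟨w₀, hw₀, hw₀x, hw₀z⟩ : ∃ w₀ ∈ R, w₀.1 ≤ x.1 ∧ w₀.1 ≤ z.1 := by
    rcases le_total x.1 z.1 with h | h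
    exacts [⟨x, hxR, le_rfl, h⟩, ⟨z, hzR, h, le_rfl⟩]
  -- The lower boundary of the gadget is brought to within `1` above the level `lo'`; the term with
  -- `m` corrects for the horizontal displacement.
  obtain ⟨dy, hdy, hdy'⟩ : ∃ dy : ℤ,
      lo' ≤ b - 1 + dy - m * (u.1 + s - w₀.1) - lineHeight m u ∧
        b - 1 + dy - m * (u.1 + s - w₀.1) - lineHeight m u ≤ lo' + 1 := by
    have f1 := Int.le_ceil (lo' - (b - 1 - m * (u.1 + s - w₀.1) - lineHeight m u))
    have f2 := Int.ceil_lt_add_one (lo' - (b - 1 - m * (u.1 + s - w₀.1) - lineHeight m u))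
    exact ⟨_, by linarith, by linarith⟩
  set d : Node := (u.1 + s - w₀.1, dy) with hd
  have hdl : ∀ q, lineHeight m (q + d) = lineHeight m q + dy - m * (u.1 + s - w₀.1) := by
    intro q; simp only [lineHeight, hd, Prod.fst_add, Prod.snd_add]; push_cast; ring
  have hdx : ∀ q : Node, (q + d).1 = q.1 + (u.1 + s - w₀.1) := fun q => rfl
  have hw₀b := hτb w₀ (hRτ w₀ hw₀)
  have hτs' : ∀ q ∈ τ, Safe N t σ (q + d) := by
    intro q hq
    obtain ⟨h1, h2, h3, h4⟩ := hτb q hq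
    refine hsafe' _ (by rw [hdx]; omega) (by rw [hdx]; omega) ?_ ?_ <;> rw [hdl] <;> linarith
  have hinj : Function.Injective (fun q : Node => q + d) := add_left_injective d
  have hmap : ∀ {P : Node → Prop}, (∀ q ∈ τ, P (q + d)) → ∀ q ∈ τ.map (· + d), P q := by
    intro P hP q hq
    obtain ⟨q', hq', rfl⟩ := List.mem_map.1 hq
    exact hP q' hq'
  obtain ⟨c1, c2, c3⟩ := basic (τ.map (· + d)) (hτn.map hinj) (hmap hτs')
  have hRτ' : ∀ q ∈ R.map (· + d), q ∈ τ.map (· + d) := by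
    intro q hq
    obtain ⟨q', hq', rfl⟩ := List.mem_map.1 hq
    exact List.mem_map_of_mem (hRτ q' hq')
  have hDσ : ∀ q ∈ diagNodes u v s k, q ∈ σ := by
    intro q hq
    obtain ⟨i, hi, rfl⟩ := mem_diagNodes.1 hq
    exact hD s k hsk _ (mem_diagWalk.2 (Or.inl ⟨s + i, by omega, by omega, rfl⟩))
  have hs0 : diagNode u v s ∈ diagNodes u v s k := mem_diagNodes.2 ⟨0, by omega, rfl⟩
  have hne : (w₀ + d) ∈ R.map (· + d) := List.mem_map_of_mem hw₀
  refine ⟨τ.map (· + d), c1, c2, c3, par _ (p.1 + (u.1 + s - w₀.1))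
    (b - 1 + dy - m * (u.1 + s - w₀.1)) (hmap fun q hq => ?_), Or.inr ⟨R.map (· + d), x + d, z + d,
    ⟨?_, hRn.map hinj⟩, hRτ', by simp [hRx], by simp [hRz], ?_, s, k, hsk, ?_, ?_, ?_, ?_⟩⟩
  · obtain ⟨h1, h2, h3, h4⟩ := hτb q hq
    rw [hdx, hdl]
    exact ⟨by omega, by omega, by linarith, by linarith⟩
  · rw [List.isChain_map]
    exact isChain_imp_of_mem hRc fun a ha b hb hab => grid_adj_iff.2
      ⟨(hτs' a (hRτ a ha)).inGrid, (hτs' b (hRτ b hb)).inGrid, by rw [l1_add, hab]⟩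
  · rw [← hRp]
    exact potential_translate d fun q hq => colorAt_translate A d hσ hτs hτs' (hRτ q hq)
  · rw [hdx, hdx, hk, Int.natCast_natAbs]
    congr 1; ring
  · rw [potential_congr (c' := A.colorAt σ)]
    · exact hpot
    · intro q hq
      exact colorAt_append_left A _ (hD s k hsk q hq)
  -- The infimum of an empty set would be `0`, so a pair of nodes has to be exhibited for the lower
  -- bound.
  · refine le_csInf ⟨_, _, hne, _, hs0, rfl⟩ ?_
    rintro _ ⟨q, hq, w, hw, rfl⟩
    exact c3 q (hRτ' q hq) w (hDσ w hw)
  · have hmem : (grid N).dist (w₀ + d) (diagNode u v s) ∈ {e : ℕ | ∃ x ∈ R.map (· + d),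
        ∃ y ∈ diagNodes u v s k, e = (grid N).dist x y} := ⟨_, hne, _, hs0, rfl⟩
    refine (Nat.sInf_le hmem).trans ?_
    rw [dist_eq_l1 (hτs' w₀ (hRτ w₀ hw₀)).inGrid (hσ _ (hDσ _ hs0))]
    have e1 : (w₀ + d).1 = (diagNode u v s).1 := by simp [hd, diagNode]
    have e2 := hdl w₀
    obtain ⟨e3, e4⟩ := lineHeight_diagNode u v s
    rw [← hmdef] at e3 e4
    have e5 : ((w₀ + d).2 : ℝ) - (diagNode u v s).2 =
        lineHeight m (w₀ + d) - lineHeight m (diagNode u v s) := by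
      simp only [lineHeight, e1]; ring
    have e6 : ((w₀ + d).2 : ℝ) - (diagNode u v s).2 ≤ 12 * t + 7 := by
      rw [e5]; linarith
    have e7 : -(12 * t + 7 : ℝ) ≤ ((w₀ + d).2 : ℝ) - (diagNode u v s).2 := by
      rw [e5]; linarith
    have e8 : (w₀ + d).2 - (diagNode u v s).2 ≤ 12 * t + 7 := by exact_mod_cast e6
    have e9 : -(12 * t + 7 : ℤ) ≤ (w₀ + d).2 - (diagNode u v s).2 := by exact_mod_cast e7
    unfold l1
    omega

/-- The diagonal path from `u` to `v` has a window of any given small span whose potential is at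
most `2` if an L-path from `u` to `v` has potential zero. -/
lemma exists_diagonal_window {N r : ℕ} (c : (grid N).Coloring (Fin 3)) {c' : Node → Fin 3}
    {W : List Node} {u v : Node} (hW : IsGridPath N W) (hu : W.head? = some u)
    (hv : W.getLast? = some v) (hm : |lineSlope u v| ≤ 1) (hend : diagNode u v r = v)
    (hin : ∀ z ∈ diagWalk u v 0 r, InGrid N z) (hcW : ∀ z ∈ W, c' z = c z)
    (hcD : ∀ z ∈ diagWalk u v 0 r, c' z = c z) (hpot : potential c' W = 0) {k : ℕ}
    (hk : k ^ 2 ≤ r) : ∃ s, s + k ≤ r ∧ |potential c' (diagWalk u v s k)| ≤ 2 := by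
  obtain ⟨h, hh⟩ := exists_grid_height c
  have hsub : ∀ s k, s + k ≤ r → ∀ z ∈ diagWalk u v s k, z ∈ diagWalk u v 0 r := by
    intro s k hsk z hz
    rcases mem_diagWalk.1 hz with ⟨i, h1, h2, h3⟩ | ⟨i, h1, h2, h3⟩
    · exact mem_diagWalk.2 (Or.inl ⟨i, by omega, by omega, h3⟩)
    · exact mem_diagWalk.2 (Or.inr ⟨i, by omega, by omega, h3⟩)
  have hD : ∀ s k, s + k ≤ r → potential c' (diagWalk u v s k) =
      h (diagNode u v s) - h (diagNode u v (s + k)) := by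
    intro s k hsk
    obtain ⟨h1, h2, h3⟩ := diagWalk_spec hm s k
    rw [potential_congr fun z hz => hcD z (hsub s k hsk z hz)]
    refine IsHeight.potential_eq ?_ h2 h3
    exact isChain_imp_of_mem h1 fun a ha b hb hab => hh a b (grid_adj_iff.2
      ⟨hin a (hsub s k hsk a ha), hin b (hsub s k hsk b hb), hab⟩)
  have huv : h u = h v := by
    rw [potential_congr hcW, IsHeight.potential_eq (hW.1.imp hh) hu hv] at hpot
    omega
  -- One step of the diagonal path uses at most two grid edges.
  have hinc : ∀ i < r, |h (diagNode u v (i + 1)) - h (diagNode u v i)| ≤ 2 := by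
    intro i hi
    have e := hD i 1 (by omega)
    have e2 : |potential c' (diagWalk u v i 1)| ≤ 2 := by
      simp only [diagWalk]
      split_ifs with h
      · have := abs_edgePotential_le c' (diagNode u v (i + 0)) (diagNode u v (i + 0 + 1))
        simp [potential] at this ⊢
        linarith
      · have b1 := abs_le.1 (abs_edgePotential_le c' (diagNode u v (i + 0))
          ((diagNode u v (i + 0 + 1)).1, (diagNode u v (i + 0)).2))
        have b2 := abs_le.1 (abs_edgePotential_le c'
          ((diagNode u v (i + 0 + 1)).1, (diagNode u v (i + 0)).2) (diagNode u v (i + 0 + 1)))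
        simp only [List.cons_append, List.nil_append, potential, add_zero]
        rw [abs_le]
        simp only [add_zero] at b1 b2
        omega
    rw [e, abs_sub_comm] at e2
    exact e2
  obtain ⟨s, h1, h2⟩ := exists_window (g := fun i => h (diagNode u v i)) hinc
    (by simp only [hend, diagNode_zero, huv]) hk
  refine ⟨s, h1, ?_⟩
  rw [hD s k h1, abs_sub_comm]
  exact h2

end OnlineGrid

/-! ### The main theorem. -/

open OnlineGrid
set_option maxHeartbeats 1000000 in
theorem mainTheorem6 :
    ∃ C : ℝ, ∀ T : ℕ → ℕ,
      (fun n : ℕ => (T n : ℝ)) =o[atTop] (fun n : ℕ => Real.log (n : ℝ)) →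
      ∀ δ : ℝ, 0 < δ → ∀ᶠ N : ℕ in atTop, ∀ t : ℕ, t = T (N ^ 2) →
      ∀ A : OnlineLocalAlg N t,
      -- the L-path `W` from `u` to `v`, placed away from the boundary of the grid
      ∀ (W : List Node) (r : ℕ) (u v : Node), IsLPath N W r →
      W.head? = some u → W.getLast? = some v → u.1 < v.1 →
      2 ^ (100 * t) ≤ r → W.length - 1 - r ≤ r →
      (∀ z ∈ W, δ * N ≤ (z.1 : ℝ) ∧ (z.1 : ℝ) ≤ (1 - δ) * N ∧
        δ * N ≤ (z.2 : ℝ) ∧ (z.2 : ℝ) ≤ (1 - δ) * N) →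
      -- so far exactly the nodes of `W` and of the diagonal path have been revealed,
      -- the algorithm has not failed yet, and `W` has potential zero
      ∀ σ : List Node, σ.Nodup →
      (∀ z, z ∈ σ ↔ z ∈ W ∨ z ∈ diagWalk u v 0 (hSpan u v)) →
      (∃ c : (grid N).Coloring (Fin 3), ∀ z ∈ σ, c z = A.colorAt σ z) →
      potential (A.colorAt σ) W = 0 →
      -- the adversary continues by revealing `τ`
      ∃ τ : List Node, (σ ++ τ).Nodup ∧ (∀ z ∈ τ, InGrid N z) ∧
        (∀ z ∈ τ, ∀ w ∈ σ, 2 * t + 2 ≤ (grid N).dist z w) ∧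
        (∃ a b w : ℝ, 0 ≤ w ∧ w ≤ 2 ^ (10 * t) * (C * t) ∧
          ∀ z ∈ τ, z ∈ parallelogram (10 * t + 1) (lineSlope u v) a b w) ∧
        ((∃ z ∈ τ, ∃ w ∈ τ, (grid N).Adj z w ∧
            A.colorAt (σ ++ τ) z = A.colorAt (σ ++ τ) w) ∨
          ∃ (R : List Node) (v₂ u₂ : Node), IsGridPath N R ∧ (∀ z ∈ R, z ∈ τ) ∧
            R.head? = some v₂ ∧ R.getLast? = some u₂ ∧
            potential (A.colorAt (σ ++ τ)) R = 10 * t ∧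
            ∃ s k : ℕ, s + k ≤ hSpan u v ∧ (k : ℤ) = |u₂.1 - v₂.1| ∧
              |potential (A.colorAt (σ ++ τ)) (diagWalk u v s k)| ≤ 2 ∧
              2 * t + 2 ≤ pathDist N R (diagNodes u v s k) ∧
              pathDist N R (diagNodes u v s k) ≤ 12 * t + 7) := by
  refine ⟨4, fun T hT δ hδ => ?_⟩
  filter_upwards [eventually_stripWidth_le hT hδ] with N hN t ht A W r u v hW hu hv huv hr hlen
    hbd σ hσn hσ hcol hpot
  rw [← ht] at hN
  set X := stripWidth t (10 * t) with hX
  obtain ⟨hx, hy, hmem⟩ := hW.spec hu hv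
  have hWlen := hW.2.1
  have hspan : hSpan u v = r := by unfold hSpan; omega
  have hr1 : v.1 - u.1 = r := by omega
  have hr1' : (v.1 : ℝ) - u.1 = r := by exact_mod_cast hr1
  have hr0 : (0 : ℝ) < r := by
    have : 0 < r := lt_of_lt_of_le (by positivity) hr
    exact_mod_cast this
  set m := lineSlope u v with hmdef
  have hmr : m * r = (v.2 : ℝ) - u.2 := by
    rw [hmdef, lineSlope, hr1', div_mul_cancel₀ _ hr0.ne']
  have hm : |m| ≤ 1 := by
    have h1 : |(v.2 : ℝ) - u.2| ≤ r := by
      have : |v.2 - u.2| ≤ r := abs_le.2 ⟨by omega, by omega⟩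
      exact_mod_cast this
    rw [← hmr, abs_mul, abs_of_pos hr0] at h1
    exact le_of_mul_le_mul_right (by linarith) hr0
  have hm' := abs_le.1 hm
  -- The column part of `W` has at least one edge, so `u` and `v` lie in different rows.
  have hm0 : m ≠ 0 := by
    intro h
    rw [h, zero_mul] at hmr
    have : v.2 - u.2 = 0 := by exact_mod_cast hmr.symm
    omega
  have ht0 : (0 : ℝ) ≤ t := Nat.cast_nonneg t
  have hX0 : (0 : ℝ) ≤ X := Nat.cast_nonneg X
  have hubd := hbd u (List.mem_of_head? hu)
  have hvbd := hbd v (List.mem_of_getLast? hv)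
  have hlu : lineHeight m v = lineHeight m u := by
    simp only [lineHeight]
    rw [show (v.1 : ℝ) = u.1 + r by linarith]
    linarith
  -- nodes near the line through `u` and `v` are far from the boundary
  have hint : ∀ z : Node, u.1 - X ≤ z.1 → z.1 ≤ v.1 + X →
      |lineHeight m z - lineHeight m u| ≤ 30 * t + 20 →
      (t : ℤ) + 1 ≤ z.1 ∧ z.1 + t ≤ N ∧ (t : ℤ) + 1 ≤ z.2 ∧ z.2 + t ≤ N := by
    intro z h1 h2 h3
    have h3 := abs_le.1 h3
    have h1' : (u.1 : ℝ) - X ≤ z.1 := by exact_mod_cast h1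
    have h2' : (z.1 : ℝ) ≤ v.1 + X := by exact_mod_cast h2
    have hy : δ * N - X ≤ u.2 + m * ((z.1 : ℝ) - u.1) ∧
        u.2 + m * ((z.1 : ℝ) - u.1) ≤ (1 - δ) * N + X := by
      have hv2 : (v.2 : ℝ) = u.2 + m * r := by linarith
      rw [hv2] at hvbd
      rcases le_total 0 m with hm1 | hm1
      · have i1 : m * -X ≤ m * ((z.1 : ℝ) - u.1) := mul_le_mul_of_nonneg_left (by linarith) hm1
        have i2 : m * ((z.1 : ℝ) - u.1) ≤ m * (r + X) :=
          mul_le_mul_of_nonneg_left (by linarith) hm1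
        have i3 : m * X ≤ 1 * X := mul_le_mul_of_nonneg_right hm'.2 hX0
        constructor <;> linarith
      · have i1 : m * ((z.1 : ℝ) - u.1) ≤ m * -X := mul_le_mul_of_nonpos_left (by linarith) hm1
        have i2 : m * (r + X) ≤ m * ((z.1 : ℝ) - u.1) :=
          mul_le_mul_of_nonpos_left (by linarith) hm1
        have i3 : -1 * X ≤ m * X := mul_le_mul_of_nonneg_right hm'.1 hX0
        constructor <;> linarith
    simp only [lineHeight] at h3
    have a1 : (t : ℝ) + 1 ≤ z.1 := by linarith
    have a2 : (z.1 : ℝ) + t ≤ N := by linarith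
    have a3 : (t : ℝ) + 1 ≤ z.2 := by linarith
    have a4 : (z.2 : ℝ) + t ≤ N := by linarith
    exact ⟨by exact_mod_cast a1, by exact_mod_cast a2, by exact_mod_cast a3, by exact_mod_cast a4⟩
  have hdx : ∀ i, (diagNode u v i).1 = u.1 + i := fun i => rfl
  -- position of the diagonal path relative to the line
  have hDpos : ∀ z ∈ diagWalk u v 0 (hSpan u v), u.1 ≤ z.1 ∧ z.1 ≤ v.1 ∧
      lineHeight m u - 1 - max m 0 ≤ lineHeight m z ∧ lineHeight m z ≤ lineHeight m u - min m 0 := by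
    intro z hz
    rw [hspan] at hz
    rcases mem_diagWalk.1 hz with ⟨i, h1, h2, rfl⟩ | ⟨i, h1, h2, -, rfl⟩
    · obtain ⟨g1, g2⟩ := lineHeight_diagNode u v i
      have := le_max_right m 0
      have := min_le_right m 0
      exact ⟨by rw [hdx]; omega, by rw [hdx]; omega, by linarith, by linarith⟩
    · obtain ⟨g1, g2⟩ := lineHeight_diagNode u v i
      have e : lineHeight m ((diagNode u v (i + 1)).1, (diagNode u v i).2) =
          lineHeight m (diagNode u v i) - m := by
        simp only [lineHeight, diagNode]; push_cast; ring
      have := le_max_left m 0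
      have := min_le_left m 0
      dsimp only
      rw [e]
      exact ⟨by rw [hdx]; omega, by rw [hdx]; omega, by linarith, by linarith⟩
  have hDin : ∀ z ∈ diagWalk u v 0 (hSpan u v), InGrid N z := by
    intro z hz
    obtain ⟨h1, h2, h3, h4⟩ := hDpos z hz
    have h5 : max m 0 ≤ 1 := max_le hm'.2 zero_le_one
    have h6 : -1 ≤ min m 0 := le_min hm'.1 (by norm_num)
    have := hint z (by omega) (by omega) (abs_le.2 ⟨by linarith, by linarith⟩)
    unfold InGrid; omega
  have hσin : ∀ z ∈ σ, InGrid N z := by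
    intro z hz
    rcases (hσ z).1 hz with h | h
    · obtain ⟨h1, h2, h3, h4⟩ := hbd z h
      have a1 : (1 : ℝ) ≤ z.1 := by linarith
      have a2 : (z.1 : ℝ) ≤ N := by linarith
      have a3 : (1 : ℝ) ≤ z.2 := by linarith
      have a4 : (z.2 : ℝ) ≤ N := by linarith
      exact ⟨by exact_mod_cast a1, by exact_mod_cast a2, by exact_mod_cast a3,
        by exact_mod_cast a4⟩
    · exact hDin z h
  -- `W` runs along its row first, so its corner is below the line for positive slope and above it
  -- for negative slope.
  have hWpos : ∀ z ∈ W, (0 < m → lineHeight m z ≤ lineHeight m u) ∧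
      (m < 0 → lineHeight m u ≤ lineHeight m z) := by
    intro z hz
    rcases hmem z hz with ⟨h1, h2, h3⟩ | ⟨h1, h2, h3⟩
    · have h4 : (u.1 : ℝ) ≤ z.1 := by
        have : u.1 ≤ z.1 := by omega
        exact_mod_cast this
      simp only [lineHeight, h1]
      constructor <;> intro h
      · have := mul_le_mul_of_nonneg_left h4 h.le
        linarith
      · have := mul_le_mul_of_nonpos_left h4 h.le
        linarith
    · rw [← hlu]
      simp only [lineHeight, h1]
      constructor <;> intro h
      · have h5 : (u.2 : ℝ) < v.2 := by linarith [mul_pos h hr0]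
        have h6 : u.2 < v.2 := by exact_mod_cast h5
        have : z.2 ≤ v.2 := by omega
        have : (z.2 : ℝ) ≤ v.2 := by exact_mod_cast this
        linarith
      · have h5 : (v.2 : ℝ) < u.2 := by linarith [mul_neg_of_neg_of_pos h hr0]
        have h6 : v.2 < u.2 := by exact_mod_cast h5
        have : v.2 ≤ z.2 := by omega
        have : (v.2 : ℝ) ≤ z.2 := by exact_mod_cast this
        linarith
  have hD : ∀ s k, s + k ≤ hSpan u v → ∀ z ∈ diagWalk u v s k, z ∈ σ := by
    intro s k hsk z hz
    refine (hσ z).2 (Or.inr (mem_diagWalk.2 ?_))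
    rcases mem_diagWalk.1 hz with ⟨i, h1, h2, h3⟩ | ⟨i, h1, h2, h3⟩
    · exact Or.inl ⟨i, by omega, by omega, h3⟩
    · exact Or.inr ⟨i, by omega, by omega, h3⟩
  have hend : diagNode u v (hSpan u v) = v := by
    rw [hspan]
    refine Prod.ext (by rw [hdx]; omega) ?_
    have e : lineSlope u v * (r : ℝ) = ((v.2 - u.2 : ℤ) : ℝ) := by push_cast; exact hmr
    simp only [diagNode, e, Int.floor_intCast]
    ring
  have hwin : ∀ k ≤ X, ∃ s, s + k ≤ hSpan u v ∧
      |potential (A.colorAt σ) (diagWalk u v s k)| ≤ 2 := by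
    intro k hk
    obtain ⟨c, hc⟩ := hcol
    refine exists_diagonal_window c hW.1 hu hv hm hend hDin
      (fun z hz => (hc z ((hσ z).2 (Or.inl hz))).symm)
      (fun z hz => (hc z ((hσ z).2 (Or.inr hz))).symm) hpot ?_
    rw [hspan]
    exact (Nat.pow_le_pow_left hk 2).trans ((stripWidth_sq_le t).trans hr)
  -- all revealed nodes lie on one side of the line; the new ones are placed on the other side
  have far : ∀ {z w : Node}, 2 * (t : ℝ) + 2 ≤ |lineHeight m z - lineHeight m w| →
      2 * t + 2 ≤ l1 z w := by
    intro z w h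
    have := h.trans (abs_lineHeight_sub_le hm z w)
    exact_mod_cast this
  rcases lt_or_gt_of_ne hm0 with hneg | hpos
  · have hside : ∀ w ∈ σ, lineHeight m u - 1 ≤ lineHeight m w := by
      intro w hw
      rcases (hσ w).1 hw with h | h
      · have := (hWpos w h).2 hneg
        linarith
      · have := (hDpos w h).2.2.1
        rw [max_eq_right hneg.le] at this
        linarith
    -- Rounding down puts diagonal nodes up to `1` below the line. Both strips end at `-(2t + 3)`,
    -- that is `2t + 2` lower still.
    refine exists_reveal_near_diagonal A hm huv hσn hσin hD hwin (lo := -(22 * t + 6))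
      (lo' := -(12 * t + 6)) le_rfl (by linarith) ?_ ?_
    all_goals
      intro z h1 h2 h3 h4
      refine ⟨hint z h1 h2 (abs_le.2 ⟨by linarith, by linarith⟩), fun w hw => far ?_⟩
      have := hside w hw
      rw [abs_sub_comm]
      exact le_trans (by linarith) (le_abs_self _)
  · have hside : ∀ w ∈ σ, lineHeight m w ≤ lineHeight m u := by
      intro w hw
      rcases (hσ w).1 hw with h | h
      · exact (hWpos w h).1 hpos
      · have := (hDpos w h).2.2.2
        rw [min_eq_right hpos.le] at this
        linarith
    -- No revealed node is above the line: rounding goes down, and for positive slope the inserted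
    -- corners lie below as well. So both strips may start at `2t + 2`.
    refine exists_reveal_near_diagonal A hm huv hσn hσin hD hwin (lo := 2 * t + 2)
      (lo' := 2 * t + 2) (by linarith) le_rfl ?_ ?_
    all_goals
      intro z h1 h2 h3 h4
      refine ⟨hint z h1 h2 (abs_le.2 ⟨by linarith, by linarith⟩), fun w hw => far ?_⟩
      have := hside w hw
      exact le_trans (by linarith) (le_abs_self _)
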